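/- Let $X$ be a finite set and $X'=\{x':x\in X\}$ a disjoint copy of $X$. A \emph{partition on $X$} is a partition of the set $X\cup X'$ into non-empty blocks; $\mathcal P_X$ denotes the set of all of them. For $\alpha,\beta\in\mathcal P_X$ the product $\alpha\beta\in\mathcal P_X$ is defined as follows. Take a third disjoint copy $X''$ of $X$, represent $\alpha$ by a graph on $X\cup X''$ (replacing each $x'$ by $x''$) and $\beta$ by a graph on $X''\cup X'$ (replacing each $x$ by $x''$) whose connected components are the blocks; then $u,v\in X\cup X'$ lie in the same block of $\alpha\beta$ if and only if they are joined by a path in the union of these two graphs. Let $\mathcal{PB}_X$ (resp. $\mathcal B_X$) be the set of all $\alpha\in\mathcal P_X$ all of whose blocks have size at most $2$ (resp. exactly $2$). For $X=\{1,\dots,n\}$, $n\ge 0$, write $\mathcal P_n,\mathcal{PB}_n,\mathcal B_n$ (the partition, partial Brauer and Brauer monoids). The \emph{kernel} of $\alpha\in\mathcal P_X$ is the join $\{(x,y)\in X\times X: x,y \text{ lie in the same block}\}\vee\{(x,y)\in X\times X: x',y'\text{ lie in the same block}\}$ in the lattice of equivalence relations on $X$, and $\alpha$ is \emph{irreducible}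 if its kernel is $X\times X$. For $\Sigma\subseteq\mathcal P_X$ let $e(\Sigma)$ be the number of $\alpha\in\Sigma$ with $\alpha^2=\alpha$, and let $c(\Sigma)$ be the number of irreducible such $\alpha$. \textbf{Theorem.} Let $\mathcal K_n$ be one of $\mathcal P_n,\mathcal B_n,\mathcal{PB}_n$ (the same choice for all $n$). Then for all $n\ge 0$ \[ e(\mathcal K_n)=n!\cdot\sum_{\mu\vdash n}\ \prod_{i=1}^n\frac{c(\mathcal K_i)^{\mu_i}}{\mu_i!\,(i!)^{\mu_i}}, \] where the sum is over all integer partitions $\mu$ of $n$ and $\mu_i$ is the number of parts of $\mu$ equal to $i$. The numbers $e(\mathcal K_n)$ satisfy the recurrence \[ e(\mathcal K_0)=1,\qquad e(\mathcal K_n)=\sum_{m=1}^n\binom{n-1}{m-1}\,c(\mathcal K_m)\,e(\mathcal K_{n-m})\quad\text{for } n\ge 1. \] Moreover, the values of $c(\mathcal K_n)$ for $n\ge1$ are \[ c(\mathcal P_n)=\sum_{r=1}^n\sum_{s=1}^n(1+rs)\,e(n,r,s), \] where $e(n,r,s)$ is the number of pairs $(\varepsilon,\eta)$ of equivalence relations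 on $\{1,\dots,n\}$ with $r$ and $s$ classes respectively such that $\varepsilon\vee\eta$ is the universal relation, and \[ c(\mathcal B_n)=\begin{cases} n! & n\text{ odd}\\ (n-1)! & n\text{ even,}\end{cases}\qquad c(\mathcal{PB}_n)=\begin{cases} 2\cdot n! & n\text{ odd}\\ (n+1)\cdot(n-1)! & n\text{ even.}\end{cases} \] -/

import Mathlib

/-- A partition on `X`: a partition of the set `X ∪ X'` into blocks, given by the equivalence
relation whose classes are the blocks. In `X ⊕ X` the left copy is the set `X` of upper vertices
and the right copy is the set `X'` of lower vertices. -/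
def DiagramPartition (X : Type*) : Type _ := Setoid (X ⊕ X)

namespace DiagramPartition

variable {X : Type*}

/-- The blocks of a partition on `X`. -/
def blocks (α : DiagramPartition X) : Set (Set (X ⊕ X)) := Setoid.classes α

/-- The vertices of a product graph: upper vertices `x`, middle vertices `x''`, lower
vertices `x'`. -/
inductive ProductVertex (X : Type*)
  | upper (x : X)
  | middle (x : X)
  | lower (x : X)

/-- The relabelling `x ↦ x`, `x' ↦ x''` applied to the left factor of a product. -/
def leftVertex : X ⊕ X → ProductVertex X := Sum.elim .upper .middle

/-- The relabelling `x ↦ x''`, `x' ↦ x'` applied to the right factor of a product. -/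
def rightVertex : X ⊕ X → ProductVertex X := Sum.elim .middle .lower

/-- The inclusion of `X ∪ X'` into the vertices of a product graph. -/
def outerVertex : X ⊕ X → ProductVertex X := Sum.elim .upper .lower

/-- The edges of the product graph of `α` and `β`; here `α` and `β` are represented by the graphs
in which any two vertices of the same block are joined. -/
inductive ProductEdge (α β : DiagramPartition X) : ProductVertex X → ProductVertex X → Prop
  | left {u v : X ⊕ X} : Setoid.r (self := α) u v →
      ProductEdge α β (leftVertex u) (leftVertex v)
  | right {u v : X ⊕ X} : Setoid.r (self := β) u v →
      ProductEdge α β (rightVertex u) (rightVertex v)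

/-- The product `αβ`: two elements of `X ∪ X'` lie in the same block if and only if they are
joined by a path in the product graph. -/
instance : Mul (DiagramPartition X) where
  mul α β := Setoid.comap outerVertex (Relation.EqvGen.setoid (ProductEdge α β))

/-- The upper kernel: `x`, `y` are related if and only if `[x] = [y]`. -/
def upperKer (α : DiagramPartition X) : Setoid X := Setoid.comap Sum.inl α

/-- The lower kernel: `x`, `y` are related if and only if `[x'] = [y']`. -/
def lowerKer (α : DiagramPartition X) : Setoid X := Setoid.comap Sum.inr α

/-- The kernel: the join of the upper and lower kernels. -/
def ker (α : DiagramPartition X) : Setoid X := upperKer α ⊔ lowerKer α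

/-- A partition on `X` is irreducible if its kernel is `X × X`. -/
def IsIrreducible (α : DiagramPartition X) : Prop := ker α = ⊤

/-- The partition monoid `P_X`. -/
def partitionMonoid (X : Type*) : Set (DiagramPartition X) := Set.univ

/-- The partial Brauer monoid `PB_X`: each block has size at most `2`. -/
def partialBrauerMonoid (X : Type*) : Set (DiagramPartition X) :=
  {α | ∀ A ∈ blocks α, A.encard ≤ 2}

/-- The Brauer monoid `B_X`: each block has size `2`. -/
def brauerMonoid (X : Type*) : Set (DiagramPartition X) :=
  {α | ∀ A ∈ blocks α, A.encard = 2}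

/-- The set `E(S)` of idempotents in `S`. -/
def idempotents (S : Set (DiagramPartition X)) : Set (DiagramPartition X) :=
  {α | α ∈ S ∧ IsIdempotentElem α}

/-- The set `C(S)` of irreducible idempotents in `S`. -/
def irreducibleIdempotents (S : Set (DiagramPartition X)) : Set (DiagramPartition X) :=
  {α | α ∈ S ∧ IsIdempotentElem α ∧ IsIrreducible α}

/-- `e(S)`, the number of idempotents in `S`. -/
noncomputable def e (S : Set (DiagramPartition X)) : ℕ := (idempotents S).ncard

/-- `c(S)`, the number of irreducible idempotents in `S`. -/
noncomputable def c (S : Set (DiagramPartition X)) : ℕ := (irreducibleIdempotents S).ncard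

/-- `e(n, r, s)`, the number of pairs of equivalence relations on an `n`-element set, with `r` and
`s` classes respectively, whose join is the universal relation. -/
noncomputable def joinPairs (n r s : ℕ) : ℕ :=
  {p : Setoid (Fin n) × Setoid (Fin n) |
    p.1.classes.ncard = r ∧ p.2.classes.ncard = s ∧ p.1 ⊔ p.2 = ⊤}.ncard

end DiagramPartition

/-! ### Idempotents in terms of kernel classes and transversal blocks. -/

namespace DiagramPartition

variable {X Y Z : Type*}

/-! In the product graph of `α` with itself, the middle row is joined up exactly along the kernel
classes of `α`. Hence `α` is idempotent iff every transversal block stays within one kernel class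
and no kernel class holds two of them (`isIdempotentElem_iff`). Both conditions, like a bound on
block sizes, can be checked one kernel class at a time, so an idempotent is a disjoint union of
irreducible idempotents on its kernel classes (`ncard_idempotents_with_ker_class`). Choosing the
class of one point gives the recurrence, and the sum over integer partitions is its solution
(`exponential_formula`). The three monoids are treated at once as `blockMonoid P`.

An irreducible idempotent amounts to kernels `ε`, `η` with join `⊤` and an optional transversal,
that is, a choice of one upper and one lower class (`c_eq_sum`). With `r` and `s` classes there are
`1 + rs` options, which settles `P_n`.

In `PB_n` and `B_n` all kernel classes have at most two elements, so `ε`, `η` are the orbit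
relations of involutions `σ`, `τ`, and the join is `⊤` iff the pair acts transitively. Such a pair
is a path or an even cycle whose edges alternate between `σ` and `τ`. Counting labellings by `{0, …,
n - 1}` gives `n!` paths, and for even `n` also `(n - 1)!` cycles. A transversal must join a fixed
point of `σ` to one of `τ`. For odd `n` each has exactly one: `PB_n` allows it to be present or
absent, and `B_n` requires it. For even `n` the two ends of a path are fixed by the same involution,
so there is no transversal: `PB_n` gets all paths and cycles, `B_n` only the cycles. -/

theorem _root_.Setoid.mem_iff_of_sup {r s : Setoid X} {T : X → Prop}
    (hr : ∀ x y, r x y → T x → T y) (hs : ∀ x y, s x y → T x → T y) {x y : X}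
    (h : (r ⊔ s) x y) : T x ↔ T y := by
  have key : r ⊔ s ≤ Setoid.ker T :=
    sup_le (fun _ _ h => propext ⟨hr _ _ h, hr _ _ (Setoid.symm' _ h)⟩)
      (fun _ _ h => propext ⟨hs _ _ h, hs _ _ (Setoid.symm' _ h)⟩)
  exact iff_of_eq (key h)

theorem _root_.Relation.EqvGen.mem_iff {r : X → X → Prop} {T : X → Prop}
    (hr : ∀ x y, r x y → (T x ↔ T y)) {x y : X} (h : Relation.EqvGen r x y) : T x ↔ T y := by
  induction h with
  | rel _ _ h => exact hr _ _ h
  | refl => rfl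
  | symm _ _ _ ih => exact ih.symm
  | trans _ _ _ _ _ ih₁ ih₂ => exact ih₁.trans ih₂

/-- Two vertices are related if they lie in the same block. -/
def Rel (α : DiagramPartition X) (u v : X ⊕ X) : Prop := Setoid.r (self := α) u v

theorem Rel.refl (α : DiagramPartition X) (u : X ⊕ X) : α.Rel u u := Setoid.refl' α u

theorem Rel.symm {α : DiagramPartition X} {u v : X ⊕ X} (h : α.Rel u v) : α.Rel v u :=
  Setoid.symm' α h

theorem Rel.trans {α : DiagramPartition X} {u v w : X ⊕ X} (h : α.Rel u v) (h' : α.Rel v w) :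
    α.Rel u w :=
  Setoid.trans' α h h'

theorem Rel.comm {α : DiagramPartition X} {u v : X ⊕ X} : α.Rel u v ↔ α.Rel v u :=
  ⟨Rel.symm, Rel.symm⟩

theorem ext_rel {α β : DiagramPartition X} (h : ∀ u v, α.Rel u v ↔ β.Rel u v) : α = β :=
  Setoid.ext h

theorem mul_rel {α β : DiagramPartition X} {u v : X ⊕ X} :
    (α * β).Rel u v ↔
      Relation.EqvGen (ProductEdge α β) (outerVertex u) (outerVertex v) :=
  Iff.rfl

theorem ker_of_upper {α : DiagramPartition X} {x y : X} (h : α.Rel (.inl x) (.inl y)) :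
    α.ker x y :=
  (le_sup_left : α.upperKer ≤ α.ker) h

theorem ker_of_lower {α : DiagramPartition X} {x y : X} (h : α.Rel (.inr x) (.inr y)) :
    α.ker x y :=
  (le_sup_right : α.lowerKer ≤ α.ker) h

theorem ker_mem_iff {α : DiagramPartition X} {T : X → Prop}
    (hu : ∀ x y, α.Rel (.inl x) (.inl y) → T x → T y)
    (hl : ∀ x y, α.Rel (.inr x) (.inr y) → T x → T y) {x y : X} (h : α.ker x y) : T x ↔ T y :=
  Setoid.mem_iff_of_sup hu hl h

/-- The middle row carries the lower blocks of the left factor and the upper blocks of the right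
factor, and these generate the kernel. -/
theorem eqvGen_middle_of_ker {α : DiagramPartition X} {x y : X} (h : α.ker x y) :
    Relation.EqvGen (ProductEdge α α) (.middle x) (.middle y) := by
  have key : α.ker ≤
      Setoid.comap ProductVertex.middle (Relation.EqvGen.setoid (ProductEdge α α)) :=
    sup_le (fun _ _ h => .rel _ _ (ProductEdge.right (u := .inl _) (v := .inl _) h))
      (fun _ _ h => .rel _ _ (ProductEdge.left (u := .inr _) (v := .inr _) h))
  exact key h

/-- An idempotent is a partition whose transversal blocks stay inside kernel classes, with at most
one transversal block in each kernel class. -/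
theorem isIdempotentElem_iff {α : DiagramPartition X} :
    IsIdempotentElem α ↔
      (∀ x y, α.Rel (.inl x) (.inr y) → α.ker x y) ∧
      ∀ x y z w, α.Rel (.inl x) (.inr y) → α.Rel (.inl z) (.inr w) → α.ker x z →
        α.Rel (.inl x) (.inl z) := by
  constructor
  · intro h
    have hmul : ∀ u v, α.Rel u v ↔
        Relation.EqvGen (ProductEdge α α) (outerVertex u) (outerVertex v) := by
      intro u v
      rw [← mul_rel, h.eq]
    have h1 : ∀ x y, α.Rel (.inl x) (.inr y) → α.ker x y := by
      intro x y hxy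
      -- `T` is the kernel class of `y` in the middle row together with the outer vertices hanging
      -- on it by a transversal block. It is closed under edges, so the path from `x` to `y'` puts
      -- `y'` in `T`; the upper vertex witnessing this shares the block of `x`.
      let T : ProductVertex X → Prop := fun p => match p with
        | .upper z => ∃ w, α.Rel (.inl z) (.inr w) ∧ α.ker w y
        | .middle w => α.ker w y
        | .lower v => ∃ w, α.Rel (.inl w) (.inr v) ∧ α.ker w y
      have hT : ∀ p q, ProductEdge α α p q → T p → T q := by
        rintro _ _ (@⟨u, v, huv⟩ | @⟨u, v, huv⟩) hp
        · change α.Rel u v at huv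
          rcases u with u | u <;> rcases v with v | v
          · obtain ⟨w, hw, hwy⟩ := hp
            exact ⟨w, huv.symm.trans hw, hwy⟩
          · obtain ⟨w, hw, hwy⟩ := hp
            exact Setoid.trans' _ (ker_of_lower (huv.symm.trans hw)) hwy
          · exact ⟨u, huv.symm, hp⟩
          · exact Setoid.trans' _ (ker_of_lower huv.symm) hp
        · change α.Rel u v at huv
          rcases u with u | u <;> rcases v with v | v
          · exact Setoid.trans' _ (ker_of_upper huv.symm) hp
          · exact ⟨u, huv, hp⟩
          · obtain ⟨w, hw, hwy⟩ := hp
            exact Setoid.trans' _ (ker_of_upper (hw.trans huv).symm) hwy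
          · obtain ⟨w, hw, hwy⟩ := hp
            exact ⟨w, hw.trans huv, hwy⟩
      have hsymm : ∀ p q, ProductEdge α α p q → ProductEdge α α q p := by
        rintro _ _ (⟨huv⟩ | ⟨huv⟩)
        · exact .left (Setoid.symm' α huv)
        · exact .right (Setoid.symm' α huv)
      obtain ⟨w, hw, hwy⟩ : T (.lower y) :=
        (Relation.EqvGen.mem_iff (fun p q h => ⟨hT p q h, hT q p (hsymm p q h)⟩)
          ((hmul _ _).1 hxy)).1 (⟨y, hxy, Setoid.refl' _ y⟩ : T (.upper x))
      exact Setoid.trans' _ (ker_of_upper (hxy.trans hw.symm)) hwy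
    refine ⟨h1, fun x y z w hxy hzw hxz => (hmul _ _).2 ?_⟩
    have e1 : Relation.EqvGen (ProductEdge α α) (.upper x) (.middle y) :=
      .rel _ _ (.left (u := .inl x) (v := .inr y) hxy)
    have e2 : Relation.EqvGen (ProductEdge α α) (.upper z) (.middle w) :=
      .rel _ _ (.left (u := .inl z) (v := .inr w) hzw)
    have hyw : α.ker y w :=
      Setoid.trans' _ (Setoid.symm' _ (h1 x y hxy)) (Setoid.trans' _ hxz (h1 z w hzw))
    exact e1.trans _ _ _ ((eqvGen_middle_of_ker hyw).trans _ _ _ (e2.symm _ _))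
  · rintro ⟨h1, h2⟩
    classical
    -- `L` is constant on components: an outer vertex outside the transversal blocks keeps its own
    -- block as label, every other vertex gets its kernel class. Equal labels thus mean a common
    -- block, or two transversal blocks in one kernel class, which `h2` identifies.
    let L : ProductVertex X → Quotient α ⊕ Quotient α.ker := fun p => match p with
      | .upper x => if ∃ y, α.Rel (.inl x) (.inr y) then .inr ⟦x⟧ else .inl ⟦.inl x⟧
      | .middle x => .inr ⟦x⟧
      | .lower y => if ∃ x, α.Rel (.inl x) (.inr y) then .inr ⟦y⟧ else .inl ⟦.inr y⟧
    have hL : ∀ p q, ProductEdge α α p q → L p = L q := by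
      rintro _ _ (@⟨u, v, huv⟩ | @⟨u, v, huv⟩)
      · change α.Rel u v at huv
        rcases u with u | u <;> rcases v with v | v
        · have : (∃ y, α.Rel (.inl u) (.inr y)) ↔ ∃ y, α.Rel (.inl v) (.inr y) :=
            exists_congr fun y => ⟨huv.symm.trans, huv.trans⟩
          simp only [L, leftVertex, Sum.elim_inl, this]
          split_ifs
          · exact congrArg _ (Quotient.sound (ker_of_upper huv))
          · exact congrArg _ (Quotient.sound huv)
        · have : ∃ y, α.Rel (.inl u) (.inr y) := ⟨v, huv⟩
          simp only [L, leftVertex, Sum.elim_inl, Sum.elim_inr, if_pos this]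
          exact congrArg _ (Quotient.sound (h1 _ _ huv))
        · have : ∃ y, α.Rel (.inl v) (.inr y) := ⟨u, huv.symm⟩
          simp only [L, leftVertex, Sum.elim_inl, Sum.elim_inr, if_pos this]
          exact congrArg _ (Quotient.sound (Setoid.symm' _ (h1 _ _ huv.symm)))
        · exact congrArg _ (Quotient.sound (ker_of_lower huv))
      · change α.Rel u v at huv
        rcases u with u | u <;> rcases v with v | v
        · exact congrArg _ (Quotient.sound (ker_of_upper huv))
        · have : ∃ x, α.Rel (.inl x) (.inr v) := ⟨u, huv⟩
          simp only [L, rightVertex, Sum.elim_inl, Sum.elim_inr, if_pos this]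
          exact congrArg _ (Quotient.sound (h1 _ _ huv))
        · have : ∃ x, α.Rel (.inl x) (.inr u) := ⟨v, huv.symm⟩
          simp only [L, rightVertex, Sum.elim_inl, Sum.elim_inr, if_pos this]
          exact congrArg _ (Quotient.sound (Setoid.symm' _ (h1 _ _ huv.symm)))
        · have : (∃ y, α.Rel (.inl y) (.inr u)) ↔ ∃ y, α.Rel (.inl y) (.inr v) :=
            exists_congr fun y => ⟨fun h => h.trans huv, fun h => h.trans huv.symm⟩
          simp only [L, rightVertex, Sum.elim_inr, this]
          split_ifs
          · exact congrArg _ (Quotient.sound (ker_of_lower huv))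
          · exact congrArg _ (Quotient.sound huv)
    have hL' : ∀ p q, Relation.EqvGen (ProductEdge α α) p q → L p = L q := fun p q h =>
      (Setoid.eqvGen_le (s := Setoid.ker L) hL) h
    have hlow : ∀ x y z w, α.Rel (.inl x) (.inr y) → α.Rel (.inl z) (.inr w) → α.ker x z →
        ∀ u ∈ ({.inl x, .inr y} : Set (X ⊕ X)), ∀ v ∈ ({.inl z, .inr w} : Set (X ⊕ X)),
          α.Rel u v := by
      intro x y z w hxy hzw hxz u hu v hv
      have hu' : α.Rel u (.inl x) := by
        rcases hu with rfl | rfl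
        exacts [.refl _ _, hxy.symm]
      have hv' : α.Rel (.inl z) v := by
        rcases hv with rfl | rfl
        exacts [.refl _ _, hzw]
      exact hu'.trans ((h2 x y z w hxy hzw hxz).trans hv')
    have htrans : ∀ x y, α.Rel (.inl x) (.inr y) → (α * α).Rel (.inl x) (.inr y) := by
      intro x y h
      have e1 : Relation.EqvGen (ProductEdge α α) (.upper x) (.middle y) :=
        .rel _ _ (.left (u := .inl x) (v := .inr y) h)
      have e2 : Relation.EqvGen (ProductEdge α α) (.middle x) (.lower y) :=
        .rel _ _ (.right (u := .inl x) (v := .inr y) h)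
      exact e1.trans _ _ _
        ((eqvGen_middle_of_ker (Setoid.symm' _ (h1 x y h))).trans _ _ _ e2)
    refine ext_rel fun u v => ⟨fun h => ?_, fun h => ?_⟩
    · have := hL' _ _ (mul_rel.1 h)
      rcases u with u | u <;> rcases v with v | v <;>
        simp only [L, outerVertex, Sum.elim_inl, Sum.elim_inr] at this <;>
        split_ifs at this with ha hb
      all_goals
        first
        | exact Quotient.exact (Sum.inl_injective this)
        | (have hk := Quotient.exact (Sum.inr_injective this)
           obtain ⟨a, ha⟩ := ha
           obtain ⟨b, hb⟩ := hb
           have hk' : α.ker u v := hk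
           have ka := h1 _ _ ha
           have kb := h1 _ _ hb
           refine hlow _ _ _ _ ha hb ?_ _ (by simp) _ (by simp)
           first
           | exact hk'
           | exact Setoid.trans' _ ka hk'
           | exact Setoid.trans' _ hk' (Setoid.symm' _ kb)
           | exact Setoid.trans' _ ka (Setoid.trans' _ hk' (Setoid.symm' _ kb)))
    · rcases u with u | u <;> rcases v with v | v
      · exact .rel _ _ (.left (u := .inl u) (v := .inl v) h)
      · exact htrans _ _ h
      · exact (htrans _ _ h.symm).symm
      · exact .rel _ _ (.right (u := .inr u) (v := .inr v) h)

end DiagramPartition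

/-! ### Restriction to kernel classes, gluing, and the recurrence. -/

namespace DiagramPartition

variable {X Y Z : Type*}

/-- The set of partitions whose block sizes all satisfy `P`. -/
def blockMonoid (P : ℕ∞ → Prop) (X : Type*) : Set (DiagramPartition X) :=
  {α | ∀ A ∈ blocks α, P A.encard}

theorem mem_blockMonoid {P : ℕ∞ → Prop} {α : DiagramPartition X} :
    α ∈ blockMonoid P X ↔ ∀ u, P {v | α.Rel v u}.encard :=
  ⟨fun h u => h _ ⟨u, rfl⟩, by rintro h _ ⟨u, rfl⟩; exact h u⟩

/-- The pullback of a partition along a map of the underlying sets. -/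
def restrict (f : Y → X) (α : DiagramPartition X) : DiagramPartition Y :=
  Setoid.comap (Sum.map f f) α

theorem restrict_rel {f : Y → X} {α : DiagramPartition X} {u v : Y ⊕ Y} :
    (restrict f α).Rel u v ↔ α.Rel (Sum.map f f u) (Sum.map f f v) :=
  Iff.rfl

/-- A set is saturated if it is a union of sets of indices of blocks. -/
def Saturates (A : Set X) (α : DiagramPartition X) : Prop :=
  ∀ u v, α.Rel u v → Sum.elim id id u ∈ A → Sum.elim id id v ∈ A

theorem Saturates.compl {A : Set X} {α : DiagramPartition X} (h : Saturates A α) :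
    Saturates Aᶜ α :=
  fun u v huv hu hv => hu (h v u huv.symm hv)

theorem mem_range_map_iff {f : Y → X} {u : X ⊕ X} :
    u ∈ Set.range (Sum.map f f) ↔ Sum.elim id id u ∈ Set.range f := by
  rcases u with u | u <;> simp

/-- A chain of upper and lower relations starting in a saturated set never leaves it, so all of its
links survive restriction. -/
theorem ker_restrict {f : Y → X} (hf : f.Injective) {α : DiagramPartition X}
    (h : Saturates (Set.range f) α) {y z : Y} :
    (restrict f α).ker y z ↔ α.ker (f y) (f z) := by
  constructor
  · intro hyz
    have key : (restrict f α).ker ≤ Setoid.comap f α.ker :=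
      sup_le (fun _ _ h => ker_of_upper (restrict_rel.1 h))
        (fun _ _ h => ker_of_lower (restrict_rel.1 h))
    exact key hyz
  · intro hyz
    let T : X → Prop := fun x => ∃ a, f a = x ∧ (restrict f α).ker y a
    obtain ⟨a, ha, hya⟩ : T (f z) := by
      refine (ker_mem_iff (T := T) ?_ ?_ hyz).1 ⟨y, rfl, Setoid.refl' _ y⟩
      · rintro _ x hx ⟨a, rfl, ha⟩
        obtain ⟨b, rfl⟩ := h _ _ hx ⟨a, rfl⟩
        exact ⟨b, rfl, Setoid.trans' _ ha (ker_of_upper (restrict_rel.2 hx))⟩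
      · rintro _ x hx ⟨a, rfl, ha⟩
        obtain ⟨b, rfl⟩ := h _ _ hx ⟨a, rfl⟩
        exact ⟨b, rfl, Setoid.trans' _ ha (ker_of_lower (restrict_rel.2 hx))⟩
    exact hf ha ▸ hya

theorem IsIdempotentElem.restrict {f : Y → X} (hf : f.Injective) {α : DiagramPartition X}
    (h : Saturates (Set.range f) α) (hα : IsIdempotentElem α) :
    IsIdempotentElem (restrict f α) := by
  rw [isIdempotentElem_iff] at hα ⊢
  exact ⟨fun x y hxy => (ker_restrict hf h).2 (hα.1 _ _ hxy),
    fun x y z w hxy hzw hxz => hα.2 _ _ _ _ hxy hzw ((ker_restrict hf h).1 hxz)⟩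

theorem encard_restrict_block {f : Y → X} (hf : f.Injective) {α : DiagramPartition X}
    (h : Saturates (Set.range f) α) (u : Y ⊕ Y) :
    {v | (restrict f α).Rel v u}.encard = {v | α.Rel v (Sum.map f f u)}.encard := by
  rw [← (hf.sumMap hf).injOn.encard_image]
  congr 1
  ext v
  constructor
  · rintro ⟨v, hv, rfl⟩
    exact hv
  · intro hv
    have : v ∈ Set.range (Sum.map f f) :=
      mem_range_map_iff.2 (h _ _ hv.symm (mem_range_map_iff.1 ⟨u, rfl⟩))
    obtain ⟨v, rfl⟩ := this
    exact ⟨v, hv, rfl⟩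

theorem restrict_mem_blockMonoid {P : ℕ∞ → Prop} {f : Y → X} (hf : f.Injective)
    {α : DiagramPartition X} (h : Saturates (Set.range f) α) (hα : α ∈ blockMonoid P X) :
    restrict f α ∈ blockMonoid P Y := by
  rw [mem_blockMonoid] at hα ⊢
  intro u
  rw [encard_restrict_block hf h]
  exact hα _

theorem saturates_range_equiv (φ : Y ≃ X) (α : DiagramPartition X) :
    Saturates (Set.range φ) α := by
  simp [Saturates]

theorem restrict_equiv_symm (φ : Y ≃ X) (α : DiagramPartition X) :
    restrict φ.symm (restrict φ α) = α :=
  ext_rel fun u v => by simp [restrict_rel]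

theorem restrict_equiv_mem_idempotents {P : ℕ∞ → Prop} (φ : Y ≃ X) {α : DiagramPartition X}
    (h : α ∈ idempotents (blockMonoid P X)) :
    restrict φ α ∈ idempotents (blockMonoid P Y) :=
  ⟨restrict_mem_blockMonoid φ.injective (saturates_range_equiv φ α) h.1,
    IsIdempotentElem.restrict φ.injective (saturates_range_equiv φ α) h.2⟩

theorem isIrreducible_restrict {f : Y → X} (hf : f.Injective) {α : DiagramPartition X}
    (h : Saturates (Set.range f) α) :
    IsIrreducible (restrict f α) ↔ ∀ y z, α.ker (f y) (f z) := by
  rw [IsIrreducible, Setoid.eq_top_iff]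
  exact forall₂_congr fun y z => ker_restrict hf h

theorem isIrreducible_iff {α : DiagramPartition X} : IsIrreducible α ↔ ∀ x y, α.ker x y :=
  Setoid.eq_top_iff

theorem restrict_equiv_mem_irreducibleIdempotents {P : ℕ∞ → Prop} (φ : Y ≃ X)
    {α : DiagramPartition X} (h : α ∈ irreducibleIdempotents (blockMonoid P X)) :
    restrict φ α ∈ irreducibleIdempotents (blockMonoid P Y) :=
  ⟨restrict_mem_blockMonoid φ.injective (saturates_range_equiv φ α) h.1,
    IsIdempotentElem.restrict φ.injective (saturates_range_equiv φ α) h.2.1,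
    (isIrreducible_restrict φ.injective (saturates_range_equiv φ α)).2
      fun _ _ => isIrreducible_iff.1 h.2.2 _ _⟩

theorem e_congr {P : ℕ∞ → Prop} (φ : Y ≃ X) : e (blockMonoid P X) = e (blockMonoid P Y) :=
  Set.BijOn.ncard_eq (f := restrict φ) <| Set.InvOn.bijOn (f' := restrict φ.symm)
    ⟨fun α _ => restrict_equiv_symm φ α, fun α _ => restrict_equiv_symm φ.symm α⟩
    (fun _ h => restrict_equiv_mem_idempotents φ h)
    (fun _ h => restrict_equiv_mem_idempotents φ.symm h)

theorem c_congr {P : ℕ∞ → Prop} (φ : Y ≃ X) : c (blockMonoid P X) = c (blockMonoid P Y) :=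
  Set.BijOn.ncard_eq (f := restrict φ) <| Set.InvOn.bijOn (f' := restrict φ.symm)
    ⟨fun α _ => restrict_equiv_symm φ α, fun α _ => restrict_equiv_symm φ.symm α⟩
    (fun _ h => restrict_equiv_mem_irreducibleIdempotents φ h)
    (fun _ h => restrict_equiv_mem_irreducibleIdempotents φ.symm h)

section Glue

variable (A : Set X)

open Classical in
/-- The block label of a vertex in the disjoint union of two partitions. -/
noncomputable def glueLabel (β : DiagramPartition A) (γ : DiagramPartition ↥Aᶜ) :
    X ⊕ X → Quotient β ⊕ Quotient γ
  | .inl x => if h : x ∈ A then .inl ⟦.inl ⟨x, h⟩⟧ else .inr ⟦.inl ⟨x, h⟩⟧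
  | .inr x => if h : x ∈ A then .inl ⟦.inr ⟨x, h⟩⟧ else .inr ⟦.inr ⟨x, h⟩⟧

/-- The disjoint union of a partition on `A` and a partition on the complement of `A`. -/
noncomputable def glue (β : DiagramPartition A) (γ : DiagramPartition ↥Aᶜ) :
    DiagramPartition X :=
  Setoid.ker (glueLabel A β γ)

variable {A} {β : DiagramPartition A} {γ : DiagramPartition ↥Aᶜ}

theorem glueLabel_left (u : A ⊕ A) :
    glueLabel A β γ (Sum.map (↑) (↑) u) = .inl ⟦u⟧ := by
  rcases u with u | u <;> exact dif_pos u.2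

theorem glueLabel_right (u : ↥Aᶜ ⊕ ↥Aᶜ) :
    glueLabel A β γ (Sum.map (↑) (↑) u) = .inr ⟦u⟧ := by
  rcases u with u | u <;> exact dif_neg u.2

theorem restrict_glue_left : restrict (fun x : A => (x : X)) (glue A β γ) = β :=
  ext_rel fun u v => by
    change glueLabel A β γ _ = glueLabel A β γ _ ↔ _
    rw [glueLabel_left, glueLabel_left, Sum.inl.injEq]
    exact Quotient.eq

theorem restrict_glue_right : restrict (fun x : ↥Aᶜ => (x : X)) (glue A β γ) = γ :=
  ext_rel fun u v => by
    change glueLabel A β γ _ = glueLabel A β γ _ ↔ _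
    rw [glueLabel_right, glueLabel_right, Sum.inr.injEq]
    exact Quotient.eq

theorem forall_vertex {p : X ⊕ X → Prop} (A : Set X) :
    (∀ u, p u) ↔ (∀ u : A ⊕ A, p (Sum.map (↑) (↑) u)) ∧
      ∀ u : ↥Aᶜ ⊕ ↥Aᶜ, p (Sum.map (↑) (↑) u) := by
  refine ⟨fun h => ⟨fun u => h _, fun u => h _⟩, fun h u => ?_⟩
  by_cases hu : Sum.elim id id u ∈ A
  · rcases u with u | u
    exacts [h.1 (.inl ⟨u, hu⟩), h.1 (.inr ⟨u, hu⟩)]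
  · rcases u with u | u
    exacts [h.2 (.inl ⟨u, hu⟩), h.2 (.inr ⟨u, hu⟩)]

theorem saturates_glue : Saturates A (glue A β γ) := by
  unfold Saturates
  simp_rw [forall_vertex A]
  refine ⟨fun u => ⟨fun v _ _ => ?_, fun v h => ?_⟩, fun u => ⟨fun v _ hu => ?_, fun v _ hu => ?_⟩⟩
  · rcases v with v | v <;> exact v.2
  · change glueLabel A β γ _ = glueLabel A β γ _ at h
    rw [glueLabel_left, glueLabel_right] at h
    cases h
  all_goals rcases u with u | u <;> exact absurd hu u.2

end Glue

section Split

variable {A : Set X} {α α' : DiagramPartition X}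

theorem saturates_left (h : Saturates A α) : Saturates (Set.range fun x : A => (x : X)) α := by
  simpa using h

theorem saturates_right (h : Saturates A α) :
    Saturates (Set.range fun x : ↥Aᶜ => (x : X)) α :=
  (Subtype.range_coe (s := Aᶜ)).symm ▸ h.compl

theorem eq_of_restrict_eq (h : Saturates A α) (h' : Saturates A α')
    (hl : restrict (fun x : A => (x : X)) α = restrict (fun x : A => (x : X)) α')
    (hr : restrict (fun x : ↥Aᶜ => (x : X)) α = restrict (fun x : ↥Aᶜ => (x : X)) α') :
    α = α' := by
  refine ext_rel ?_
  have key : ∀ {α : DiagramPartition X}, Saturates A α → ∀ (u : A ⊕ A) (v : ↥Aᶜ ⊕ ↥Aᶜ),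
      ¬ α.Rel (Sum.map (↑) (↑) u) (Sum.map (↑) (↑) v) := by
    intro α h u v huv
    have := h _ _ huv
    rcases u with u | u <;> rcases v with v | v <;> exact v.2 (this u.2)
  simp_rw [forall_vertex A]
  refine ⟨fun u => ⟨fun v => ?_, fun v => iff_of_false (key h u v) (key h' u v)⟩,
    fun u => ⟨fun v => iff_of_false (fun huv => key h v u huv.symm)
      (fun huv => key h' v u huv.symm), fun v => ?_⟩⟩
  · exact iff_of_eq (congrArg (fun β => Rel β u v) hl)
  · exact iff_of_eq (congrArg (fun β => Rel β u v) hr)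

theorem mem_blockMonoid_of_restrict {P : ℕ∞ → Prop} (h : Saturates A α)
    (hl : restrict (fun x : A => (x : X)) α ∈ blockMonoid P A)
    (hr : restrict (fun x : ↥Aᶜ => (x : X)) α ∈ blockMonoid P ↥Aᶜ) : α ∈ blockMonoid P X := by
  rw [mem_blockMonoid] at *
  rw [forall_vertex A]
  refine ⟨fun u => ?_, fun u => ?_⟩
  · have := hl u
    rwa [encard_restrict_block Subtype.val_injective (saturates_left h)] at this
  · have := hr u
    rwa [encard_restrict_block Subtype.val_injective (saturates_right h)] at this

/-- The conditions of `isIdempotentElem_iff` compare only points of one block or of one kernel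
class, and saturation keeps these on one side of `A`. -/
theorem isIdempotentElem_of_restrict (h : Saturates A α)
    (hl : IsIdempotentElem (restrict (fun x : A => (x : X)) α))
    (hr : IsIdempotentElem (restrict (fun x : ↥Aᶜ => (x : X)) α)) : IsIdempotentElem α := by
  rw [isIdempotentElem_iff] at *
  have kl := @ker_restrict _ _ _ Subtype.val_injective α (saturates_left h)
  have kr := @ker_restrict _ _ _ Subtype.val_injective α (saturates_right h)
  have hk : ∀ {x y}, α.ker x y → (x ∈ A ↔ y ∈ A) := fun hxy =>
    ker_mem_iff (T := fun x => x ∈ A) (fun x y hxy => h _ _ hxy) (fun x y hxy => h _ _ hxy) hxy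
  refine ⟨fun x y hxy => ?_, fun x y z w hxy hzw hxz => ?_⟩
  · by_cases hx : x ∈ A
    · exact kl.1 (hl.1 ⟨x, hx⟩ ⟨y, h _ _ hxy hx⟩ hxy)
    · exact kr.1 (hr.1 ⟨x, hx⟩ ⟨y, h.compl _ _ hxy hx⟩ hxy)
  · by_cases hx : x ∈ A
    · have hz : z ∈ A := (hk hxz).1 hx
      exact hl.2 ⟨x, hx⟩ ⟨y, h _ _ hxy hx⟩ ⟨z, hz⟩ ⟨w, h _ _ hzw hz⟩ hxy hzw (kl.2 hxz)
    · have hz : z ∈ Aᶜ := fun hz => hx ((hk hxz).2 hz)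
      exact hr.2 ⟨x, hx⟩ ⟨y, h.compl _ _ hxy hx⟩ ⟨z, hz⟩ ⟨w, h.compl _ _ hzw hz⟩ hxy hzw
        (kr.2 hxz)

/-- Idempotency keeps transversal blocks inside kernel classes, so the class `A` of `x₀` is
saturated. Restriction to `A` is then irreducible, restriction to the complement is an arbitrary
idempotent, and `glue` inverts the pair of restrictions. -/
theorem ncard_idempotents_with_ker_class (P : ℕ∞ → Prop) {x₀ : X} (hx₀ : x₀ ∈ A) :
    {α ∈ idempotents (blockMonoid P X) | ∀ x, α.ker x₀ x ↔ x ∈ A}.ncard =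
      c (blockMonoid P A) * e (blockMonoid P ↥Aᶜ) := by
  rw [c, e, ← Set.ncard_prod]
  have hsat : ∀ α ∈ {α ∈ idempotents (blockMonoid P X) | ∀ x, α.ker x₀ x ↔ x ∈ A},
      Saturates A α := by
    rintro α ⟨hα, hA⟩ u v huv hu
    refine (hA _).1 (Setoid.trans' _ ((hA _).2 hu) ?_)
    have hi := (isIdempotentElem_iff.1 hα.2).1
    rcases u with u | u <;> rcases v with v | v
    · exact ker_of_upper huv
    · exact hi _ _ huv
    · exact Setoid.symm' _ (hi _ _ huv.symm)
    · exact ker_of_lower huv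
  refine Set.BijOn.ncard_eq
    (f := fun α => (restrict (fun x : A => (x : X)) α, restrict (fun x : ↥Aᶜ => (x : X)) α))
    ⟨?_, ?_, ?_⟩
  · intro α hα
    have hs := hsat α hα
    obtain ⟨⟨hα, hi⟩, hA⟩ := hα
    refine ⟨⟨restrict_mem_blockMonoid Subtype.val_injective (saturates_left hs) hα,
      IsIdempotentElem.restrict Subtype.val_injective (saturates_left hs) hi,
      (isIrreducible_restrict Subtype.val_injective (saturates_left hs)).2 fun y z =>
        Setoid.trans' _ (Setoid.symm' _ ((hA y).2 y.2)) ((hA z).2 z.2)⟩,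
      restrict_mem_blockMonoid Subtype.val_injective (saturates_right hs) hα,
      IsIdempotentElem.restrict Subtype.val_injective (saturates_right hs) hi⟩
  · intro α hα α' hα' h
    exact eq_of_restrict_eq (hsat α hα) (hsat α' hα') (congrArg Prod.fst h) (congrArg Prod.snd h)
  · rintro ⟨β, γ⟩ ⟨⟨hβ, hβi, hβk⟩, hγ, hγi⟩
    have hs : Saturates A (glue A β γ) := saturates_glue
    refine ⟨glue A β γ, ⟨⟨mem_blockMonoid_of_restrict hs ?_ ?_,
      isIdempotentElem_of_restrict hs ?_ ?_⟩, fun x => ⟨fun hx => ?_, fun hx => ?_⟩⟩, ?_⟩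
    · rwa [restrict_glue_left]
    · rwa [restrict_glue_right]
    · rwa [restrict_glue_left]
    · rwa [restrict_glue_right]
    · exact (ker_mem_iff (T := fun x => x ∈ A) (fun x y hxy => hs _ _ hxy)
        (fun x y hxy => hs _ _ hxy) hx).1 hx₀
    · refine (isIrreducible_restrict Subtype.val_injective (saturates_left hs)).1 ?_
        ⟨x₀, hx₀⟩ ⟨x, hx⟩
      rwa [restrict_glue_left]
    · exact Prod.ext restrict_glue_left restrict_glue_right

end Split

instance [Finite X] : Finite (DiagramPartition X) :=
  Finite.of_injective (fun α => α.Rel) fun _ _ h => ext_rel fun u v => iff_of_eq (congrFun₂ h u v)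

theorem c_eq_of_card (P : ℕ∞ → Prop) [Finite X] {n : ℕ} (h : Nat.card X = n) :
    c (blockMonoid P X) = c (blockMonoid P (Fin n)) :=
  c_congr ((Finite.equivFinOfCardEq h).symm)

theorem e_eq_of_card (P : ℕ∞ → Prop) [Finite X] {n : ℕ} (h : Nat.card X = n) :
    e (blockMonoid P X) = e (blockMonoid P (Fin n)) :=
  e_congr ((Finite.equivFinOfCardEq h).symm)

/-- Idempotents are sorted by the kernel class of the point `0`. -/
theorem e_recurrence_aux (P : ℕ∞ → Prop) (n : ℕ) :
    e (blockMonoid P (Fin (n + 1))) = ∑ A : Finset (Fin (n + 1)) with 0 ∈ A,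
      c (blockMonoid P (Fin A.card)) * e (blockMonoid P (Fin (n + 1 - A.card))) := by
  classical
  have := Fintype.ofFinite (DiagramPartition (Fin (n + 1)))
  rw [e, Set.ncard_eq_toFinset_card',
    Finset.card_eq_sum_card_fiberwise
      (f := fun α : DiagramPartition (Fin (n + 1)) => Finset.univ.filter fun x => α.ker 0 x)
      (t := Finset.univ.filter fun A : Finset (Fin (n + 1)) => 0 ∈ A)]
  · refine Finset.sum_congr rfl fun A hA => ?_
    have h0 : (0 : Fin (n + 1)) ∈ (A : Set (Fin (n + 1))) := by simpa using hA
    rw [← c_eq_of_card P (X := (A : Set (Fin (n + 1)))) (by simp),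
      ← e_eq_of_card P (X := ↥((A : Set (Fin (n + 1)))ᶜ)) (by
        rw [Nat.card_coe_set_eq, Set.ncard_compl]; simp),
      ← ncard_idempotents_with_ker_class P h0, ← Set.ncard_coe_finset]
    congr 1
    ext α
    simp [Finset.ext_iff]
  · intro α _
    simp

theorem sum_finset_mem_zero {M : Type*} [AddCommMonoid M] (n : ℕ) (g : ℕ → M) :
    ∑ A : Finset (Fin (n + 1)) with 0 ∈ A, g A.card =
      ∑ m ∈ Finset.range (n + 1), n.choose m • g (m + 1) := by
  have h := Finset.sum_powerset_apply_card (fun m => g (m + 1))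
    (x := (Finset.univ : Finset (Fin (n + 1))).erase 0)
  rw [Finset.card_erase_of_mem (Finset.mem_univ _), Finset.card_univ, Fintype.card_fin,
    Nat.add_sub_cancel] at h
  rw [← h]
  refine Finset.sum_nbij' (fun A => A.erase 0) (fun B => insert 0 B) ?_ ?_ ?_ ?_ ?_
  · intro A _
    simpa using Finset.erase_subset_erase 0 (Finset.subset_univ A)
  · intro B _
    simp
  · intro A hA
    exact Finset.insert_erase (by simpa using hA)
  · intro B hB
    refine Finset.erase_insert fun h0 => ?_
    simpa using Finset.mem_powerset.1 hB h0
  · intro A hA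
    rw [Finset.card_erase_add_one (by simpa using hA)]

theorem e_recurrence (P : ℕ∞ → Prop) {n : ℕ} (hn : 1 ≤ n) :
    e (blockMonoid P (Fin n)) = ∑ m ∈ Finset.Icc 1 n,
      (n - 1).choose (m - 1) * c (blockMonoid P (Fin m)) * e (blockMonoid P (Fin (n - m))) := by
  obtain ⟨n, rfl⟩ := Nat.exists_eq_add_of_le' hn
  rw [e_recurrence_aux, sum_finset_mem_zero n fun m =>
    c (blockMonoid P (Fin m)) * e (blockMonoid P (Fin (n + 1 - m)))]
  refine Finset.sum_nbij' (fun m => m + 1) (fun m => m - 1) ?_ ?_ ?_ ?_ ?_ <;>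
    simp only [Finset.mem_range, Finset.mem_Icc]
  · omega
  · omega
  · omega
  · omega
  · intro m _
    simp [mul_assoc]

theorem e_zero (P : ℕ∞ → Prop) : e (blockMonoid P (Fin 0)) = 1 := by
  have hsub : ∀ α β : DiagramPartition (Fin 0), α = β := fun α β =>
    ext_rel fun u => by rcases u with u | u <;> exact u.elim0
  rw [e, Set.ncard_eq_one]
  refine ⟨(⊤ : Setoid _), Set.eq_singleton_iff_unique_mem.2 ⟨⟨mem_blockMonoid.2 ?_, hsub _ _⟩,
    fun _ _ => hsub _ _⟩⟩
  rintro (u | u) <;> exact u.elim0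

end DiagramPartition

/-! ### The exponential formula as a sum over integer partitions. -/

namespace Nat.Partition

variable {F : Type*} [Field F] [CharZero F]

/-- The weight of a multiset of natural numbers in the exponential formula. -/
def expWeight (a : ℕ → F) (U : Finset ℕ) (s : Multiset ℕ) : F :=
  ∏ i ∈ U, a i ^ s.count i / (s.count i).factorial

/-- The multiplicity cancels one factor of the factorial, as in differentiating `a ^ k / k!`. -/
theorem expWeight_cons (a : ℕ → F) {U : Finset ℕ} {i : ℕ} (hi : i ∈ U) (s : Multiset ℕ) :
    ((i ::ₘ s).count i : F) * expWeight a U (i ::ₘ s) = a i * expWeight a U s := by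
  rw [expWeight, expWeight, ← Finset.mul_prod_erase _ _ hi, ← Finset.mul_prod_erase _ _ hi,
    Finset.prod_congr rfl fun j hj => by
      rw [Multiset.count_cons_of_ne (Finset.ne_of_mem_erase hj)],
    Multiset.count_cons_self, Nat.factorial_succ]
  have h1 : ((s.count i + 1 : ℕ) : F) ≠ 0 := Nat.cast_ne_zero.2 (Nat.succ_ne_zero _)
  have h2 : ((s.count i).factorial : F) ≠ 0 := Nat.cast_ne_zero.2 (Nat.factorial_ne_zero _)
  rw [← mul_assoc, ← mul_assoc, Nat.cast_mul]
  congr 1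
  field_simp
  ring

/-- An index that is not a part contributes `a ^ 0 / 0! = 1`. -/
theorem expWeight_parts (a : ℕ → F) {m n : ℕ} (h : m ≤ n) (μ : Nat.Partition m) :
    expWeight a (Finset.Icc 1 n) μ.parts = expWeight a (Finset.Icc 1 m) μ.parts := by
  refine (Finset.prod_subset (Finset.Icc_subset_Icc_right h) fun i _ hi => ?_).symm
  have : i ∉ μ.parts := fun hm => hi (Finset.mem_Icc.2
    ⟨μ.parts_pos hm, (Multiset.single_le_sum (by simp) i hm).trans_eq μ.parts_sum⟩)
  simp [Multiset.count_eq_zero.2 this]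

/-- Partitions without the part `i` contribute zero; the others arise uniquely by adding `i` to a
partition of `n - i`. -/
theorem sum_mul_expWeight (a : ℕ → F) {n i : ℕ} (hi : i ∈ Finset.Icc 1 n) :
    ∑ μ : Nat.Partition n, (μ.parts.count i : F) * expWeight a (Finset.Icc 1 n) μ.parts =
      a i * ∑ ν : Nat.Partition (n - i), expWeight a (Finset.Icc 1 (n - i)) ν.parts := by
  classical
  have hi' := Finset.mem_Icc.1 hi
  rw [← Finset.sum_filter_of_ne (p := fun μ : Nat.Partition n => i ∈ μ.parts), Finset.mul_sum]
  · symm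
    refine Finset.sum_nbij (fun ν : Nat.Partition (n - i) =>
      (⟨i ::ₘ ν.parts, ?_, ?_⟩ : Nat.Partition n)) ?_ ?_ ?_ ?_
    · intro j hj
      rcases Multiset.mem_cons.1 hj with rfl | hj
      exacts [hi'.1, ν.parts_pos hj]
    · rw [Multiset.sum_cons, ν.parts_sum]
      omega
    · intro ν _
      simp
    · intro ν _ ν' _ h
      exact Nat.Partition.ext ((Multiset.cons_inj_right i).1 (congrArg Nat.Partition.parts h))
    · intro μ hμ
      have hμ : i ∈ μ.parts := by simpa using hμ
      have hc := Multiset.cons_erase hμ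
      refine ⟨⟨μ.parts.erase i, fun hj => μ.parts_pos (Multiset.mem_of_mem_erase hj), ?_⟩,
        by simp, Nat.Partition.ext hc⟩
      have := congrArg Multiset.sum hc
      rw [Multiset.sum_cons, μ.parts_sum] at this
      omega
    · intro ν _
      rw [expWeight_cons a hi, expWeight_parts a (Nat.sub_le n i)]
  · intro μ _ h
    by_contra hm
    simp [Multiset.count_eq_zero.2 hm] at h

/-- Write `n` as the sum of `i * count i` inside each partition and exchange the sums. For
generating functions this is `F' = A' F` with `F = exp A`. -/
theorem natCast_mul_sum_expWeight (a : ℕ → F) (n : ℕ) :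
    (n : F) * ∑ μ : Nat.Partition n, expWeight a (Finset.Icc 1 n) μ.parts =
      ∑ i ∈ Finset.Icc 1 n, i * (a i *
        ∑ ν : Nat.Partition (n - i), expWeight a (Finset.Icc 1 (n - i)) ν.parts) := by
  rw [Finset.sum_congr (s₁ := Finset.Icc 1 n) rfl
    fun i hi => congrArg ((i : F) * ·) (sum_mul_expWeight a hi).symm]
  simp_rw [Finset.mul_sum]
  rw [Finset.sum_comm]
  refine Finset.sum_congr rfl fun μ _ => ?_
  simp_rw [← mul_assoc]
  rw [← Finset.sum_mul]
  congr 1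
  have h := Finset.sum_multiset_count_of_subset μ.parts (Finset.Icc 1 n) fun i hm => by
    rw [Multiset.mem_toFinset] at hm
    exact Finset.mem_Icc.2
      ⟨μ.parts_pos hm, (Multiset.single_le_sum (by simp) i hm).trans_eq μ.parts_sum⟩
  rw [μ.parts_sum] at h
  conv_lhs => rw [h]
  rw [Nat.cast_sum]
  exact Finset.sum_congr rfl fun i _ => by rw [smul_eq_mul, mul_comm, Nat.cast_mul]

/-- The exponential formula, for a sequence given by the recurrence for the number of structures
that decompose into connected ones. -/
theorem exponential_formula {e c : ℕ → ℕ} (h0 : e 0 = 1)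
    (h : ∀ n, 1 ≤ n → e n = ∑ m ∈ Finset.Icc 1 n, (n - 1).choose (m - 1) * c m * e (n - m))
    (n : ℕ) :
    (e n : F) = n.factorial * ∑ μ : Nat.Partition n,
      expWeight (fun i => (c i : F) / i.factorial) (Finset.Icc 1 n) μ.parts := by
  induction n using Nat.strong_induction_on with
  | _ n ih =>
  rcases Nat.eq_zero_or_pos n with rfl | hn
  · simp [h0, expWeight]
  obtain ⟨n, rfl⟩ := Nat.exists_eq_add_of_le' hn
  -- The factor `n + 1` of the factorial is absorbed by `natCast_mul_sum_expWeight`; the two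
  -- recurrences then agree term by term.
  rw [Nat.factorial_succ, mul_comm (n + 1), Nat.cast_mul, mul_assoc, natCast_mul_sum_expWeight,
    h _ hn, Nat.cast_sum, Finset.mul_sum]
  refine Finset.sum_congr rfl fun m hm => ?_
  obtain ⟨h1, h2⟩ := Finset.mem_Icc.1 hm
  obtain ⟨m, rfl⟩ := Nat.exists_eq_add_of_le' h1
  have hmn : m ≤ n := by omega
  rw [Nat.cast_mul, Nat.cast_mul, ih (n + 1 - (m + 1)) (by omega), Nat.add_sub_add_right n 1 m,
    Nat.add_sub_cancel, Nat.add_sub_cancel, Nat.factorial_succ,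
    ← Nat.choose_mul_factorial_mul_factorial hmn]
  have h3 : ((m + 1 : ℕ) : F) ≠ 0 := Nat.cast_ne_zero.2 (Nat.succ_ne_zero _)
  have h4 : (m.factorial : F) ≠ 0 := Nat.cast_ne_zero.2 (Nat.factorial_ne_zero _)
  simp only [Nat.cast_mul]
  field_simp

end Nat.Partition

namespace DiagramPartition

theorem e_eq_sum_partition (P : ℕ∞ → Prop) (n : ℕ) :
    (e (blockMonoid P (Fin n)) : ℚ) =
      (n.factorial : ℚ) * ∑ μ : Nat.Partition n, ∏ i ∈ Finset.Icc 1 n,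
        (c (blockMonoid P (Fin i)) : ℚ) ^ (μ.parts.count i) /
          (((μ.parts.count i).factorial : ℚ) * (i.factorial : ℚ) ^ (μ.parts.count i)) := by
  rw [Nat.Partition.exponential_formula (F := ℚ) (e := fun n => e (blockMonoid P (Fin n)))
    (c := fun n => c (blockMonoid P (Fin n))) (e_zero P) (fun n hn => e_recurrence P hn) n]
  congr 1
  refine Finset.sum_congr rfl fun μ _ => Finset.prod_congr rfl fun i _ => ?_
  rw [div_pow, div_div, mul_comm]

end DiagramPartition

/-! ### Irreducible idempotents as pairs of kernels with at most one transversal block; the count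
for `P_n`. -/

namespace DiagramPartition

variable {X : Type*} {ε η : Setoid X}

open Classical in
/-- The block label of a vertex in the partition with upper kernel `ε`, lower kernel `η`, and at
most one transversal block, given by an upper and a lower class. -/
noncomputable def joinLabel (ε η : Setoid X) :
    Option (Quotient ε × Quotient η) → X ⊕ X → Quotient ε ⊕ Quotient η
  | none => Sum.map (Quotient.mk ε) (Quotient.mk η)
  | some (a, b) => Sum.elim (fun x => .inl (Quotient.mk ε x))
      (fun y => if Quotient.mk η y = b then .inl a else .inr (Quotient.mk η y))

/-- The partition with upper kernel `ε`, lower kernel `η`, and at most one transversal block, given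
by an upper and a lower class. -/
noncomputable def ofKernels (ε η : Setoid X) (o : Option (Quotient ε × Quotient η)) :
    DiagramPartition X :=
  Setoid.ker (joinLabel ε η o)

variable {o : Option (Quotient ε × Quotient η)} {x y : X}

theorem ofKernels_rel {u v : X ⊕ X} :
    (ofKernels ε η o).Rel u v ↔ joinLabel ε η o u = joinLabel ε η o v :=
  Iff.rfl

theorem ofKernels_upper : (ofKernels ε η o).Rel (.inl x) (.inl y) ↔ ε x y := by
  rw [ofKernels_rel]
  rcases o with _ | ⟨a, b⟩ <;> simp [joinLabel, Quotient.eq]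

theorem ofKernels_lower : (ofKernels ε η o).Rel (.inr x) (.inr y) ↔ η x y := by
  rw [ofKernels_rel, ← Quotient.eq]
  rcases o with _ | ⟨a, b⟩
  · simp [joinLabel]
  · simp only [joinLabel, Sum.elim_inr]
    split_ifs with h1 h2 h2
    · simp [h1, h2]
    · simp [h1, Ne.symm h2]
    · simp [h1, h2]
    · simp

theorem ofKernels_transversal :
    (ofKernels ε η o).Rel (.inl x) (.inr y) ↔ o = some (Quotient.mk ε x, Quotient.mk η y) := by
  rw [ofKernels_rel]
  rcases o with _ | ⟨a, b⟩
  · simp [joinLabel]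
  · simp only [joinLabel, Sum.elim_inr, Sum.elim_inl]
    split_ifs with h
    · simp [h, eq_comm]
    · simp [Ne.symm h]

theorem ext_rel_cases {α β : DiagramPartition X}
    (hu : ∀ x y, α.Rel (.inl x) (.inl y) ↔ β.Rel (.inl x) (.inl y))
    (hl : ∀ x y, α.Rel (.inr x) (.inr y) ↔ β.Rel (.inr x) (.inr y))
    (ht : ∀ x y, α.Rel (.inl x) (.inr y) ↔ β.Rel (.inl x) (.inr y)) : α = β := by
  refine ext_rel fun u v => ?_
  rcases u with u | u <;> rcases v with v | v
  · exact hu _ _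
  · exact ht _ _
  · rw [Rel.comm, ht, Rel.comm]
  · exact hl _ _

theorem ker_ofKernels : (ofKernels ε η o).ker = ε ⊔ η := by
  have h1 : (ofKernels ε η o).upperKer = ε := Setoid.ext fun _ _ => ofKernels_upper
  have h2 : (ofKernels ε η o).lowerKer = η := Setoid.ext fun _ _ => ofKernels_lower
  rw [ker, h1, h2]

theorem ofKernels_injective {ε' η' : Setoid X} {o' : Option (Quotient ε' × Quotient η')}
    (h : ofKernels ε η o = ofKernels ε' η' o') :
    (⟨(ε, η), o⟩ : Σ p : Setoid X × Setoid X, Option (Quotient p.1 × Quotient p.2)) =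
      ⟨(ε', η'), o'⟩ := by
  have h1 : ε = ε' := Setoid.ext fun x y => by
    rw [← ofKernels_upper (o := o), h, ofKernels_upper]
  have h2 : η = η' := Setoid.ext fun x y => by
    rw [← ofKernels_lower (o := o), h, ofKernels_lower]
  subst h1 h2
  congr 1
  refine Option.ext ?_
  rintro ⟨⟨x⟩, ⟨y⟩⟩
  change o = some (Quotient.mk ε x, Quotient.mk η y) ↔ o' = some (Quotient.mk ε x, Quotient.mk η y)
  rw [← ofKernels_transversal, h, ofKernels_transversal]

/-- With a single kernel class and a single possible transversal, both conditions of
`isIdempotentElem_iff` are automatic. -/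
theorem isIdempotentElem_ofKernels (h : ε ⊔ η = ⊤) :
    IsIdempotentElem (ofKernels ε η o) := by
  rw [isIdempotentElem_iff]
  refine ⟨fun x y _ => ?_, fun x y z w hxy hzw _ => ?_⟩
  · rw [ker_ofKernels, h]
    trivial
  · rw [ofKernels_transversal] at hxy hzw
    rw [ofKernels_upper, ← Quotient.eq]
    exact congrArg Prod.fst (Option.some_injective _ (hxy.symm.trans hzw))

/-- With a single kernel class, idempotency leaves room for at most one transversal block, which is
the union of one upper and one lower class. -/
theorem exists_eq_ofKernels {α : DiagramPartition X} (hα : IsIdempotentElem α)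
    (hi : IsIrreducible α) : ∃ o, α = ofKernels α.upperKer α.lowerKer o := by
  by_cases h : ∃ x y, α.Rel (.inl x) (.inr y)
  · obtain ⟨x, y, hxy⟩ := h
    refine ⟨some (Quotient.mk _ x, Quotient.mk _ y), ext_rel_cases (fun z w => ?_) (fun z w => ?_)
      (fun z w => ?_)⟩
    · rw [ofKernels_upper]
      rfl
    · rw [ofKernels_lower]
      rfl
    · rw [ofKernels_transversal, Option.some_inj, Prod.mk.injEq, Quotient.eq, Quotient.eq]
      change _ ↔ α.Rel (.inl x) (.inl z) ∧ α.Rel (.inr y) (.inr w)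
      refine ⟨fun hzw => ?_, fun ⟨h1, h2⟩ => h1.symm.trans (hxy.trans h2)⟩
      have := (isIdempotentElem_iff.1 hα).2 _ _ _ _ hxy hzw (isIrreducible_iff.1 hi _ _)
      exact ⟨this, hxy.symm.trans (this.trans hzw)⟩
  · refine ⟨none, ext_rel_cases (fun z w => ?_) (fun z w => ?_) (fun z w => ?_)⟩
    · rw [ofKernels_upper]
      rfl
    · rw [ofKernels_lower]
      rfl
    · rw [ofKernels_transversal]
      exact iff_of_false (fun hzw => h ⟨z, w, hzw⟩) (by simp)

open Classical in
theorem c_eq_sum [Fintype X] [Fintype (Setoid X)] (S : Set (DiagramPartition X)) :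
    c S = ∑ p : Setoid X × Setoid X with p.1 ⊔ p.2 = ⊤, {o | ofKernels p.1 p.2 o ∈ S}.ncard := by
  have key : ((Finset.univ.filter fun p : Setoid X × Setoid X => p.1 ⊔ p.2 = ⊤).sigma
      fun p => {o | ofKernels p.1 p.2 o ∈ S}.toFinset).card = c S := by
    rw [← Set.ncard_coe_finset, c]
    refine Set.BijOn.ncard_eq (f := fun q => ofKernels q.1.1 q.1.2 q.2) ⟨?_, ?_, ?_⟩
    · rintro ⟨⟨ε, η⟩, o⟩ h
      simp only [Finset.coe_sigma, Set.mem_sigma_iff, Finset.coe_filter, Finset.mem_univ,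
        true_and, Set.mem_ofPred_eq, Set.coe_toFinset] at h
      exact ⟨h.2, isIdempotentElem_ofKernels h.1, ker_ofKernels.trans h.1⟩
    · rintro ⟨⟨ε, η⟩, o⟩ _ ⟨⟨ε', η'⟩, o'⟩ _ h
      exact ofKernels_injective h
    · rintro α ⟨hα, hi, hk⟩
      obtain ⟨o, ho⟩ := exists_eq_ofKernels hi hk
      refine ⟨⟨(α.upperKer, α.lowerKer), o⟩, ?_, ho.symm⟩
      simp only [Finset.coe_sigma, Set.mem_sigma_iff, Finset.coe_filter, Finset.mem_univ,
        true_and, Set.mem_ofPred_eq, Set.coe_toFinset]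
      exact ⟨hk, ho ▸ hα⟩
  rw [← key, Finset.card_sigma]
  simp_rw [Set.ncard_eq_toFinset_card']

open Classical in
theorem _root_.Option.ncard_setOf {A : Type*} [Finite A] (p : Option A → Prop) :
    {o | p o}.ncard = (if p none then 1 else 0) + {a | p (some a)}.ncard := by
  have h : {o | p o} = {o | o = none ∧ p none} ∪ some '' {a | p (some a)} := by
    ext (_ | a) <;> simp
  rw [h, Set.ncard_union_eq, Set.ncard_image_of_injective _ (Option.some_injective A)]
  · congr 1
    split_ifs with hn <;> simp [hn]
  · rw [Set.disjoint_left]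
    rintro _ ⟨rfl, _⟩ ⟨a, _, h⟩
    cases h

theorem partitionMonoid_eq_blockMonoid :
    partitionMonoid X = blockMonoid (fun _ => True) X := by
  simp [partitionMonoid, blockMonoid]

theorem ncard_classes (ε : Setoid X) : ε.classes.ncard = Nat.card (Quotient ε) :=
  (Nat.card_congr ε.quotientEquivClasses).symm

theorem ncard_classes_mem_Icc {n : ℕ} (hn : 1 ≤ n) (ε : Setoid (Fin n)) :
    ε.classes.ncard ∈ Finset.Icc 1 n := by
  have : Nonempty (Quotient ε) := ⟨Quotient.mk ε ⟨0, hn⟩⟩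
  rw [ncard_classes, Finset.mem_Icc]
  refine ⟨Nat.card_pos, ?_⟩
  simpa using Nat.card_le_card_of_surjective (Quotient.mk ε) Quotient.mk_surjective

theorem c_partitionMonoid {n : ℕ} (hn : 1 ≤ n) :
    c (partitionMonoid (Fin n)) =
      ∑ r ∈ Finset.Icc 1 n, ∑ s ∈ Finset.Icc 1 n, (1 + r * s) * joinPairs n r s := by
  classical
  have : Finite (Setoid (Fin n)) := Finite.of_injective (fun ε : Setoid (Fin n) => ⇑ε)
    fun ε η h => Setoid.ext fun x y => iff_of_eq (congrFun₂ h x y)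
  have := Fintype.ofFinite (Setoid (Fin n))
  rw [c_eq_sum, ← Finset.sum_product',
    ← Finset.sum_fiberwise_of_maps_to (t := Finset.Icc 1 n ×ˢ Finset.Icc 1 n)
      (g := fun p : Setoid (Fin n) × Setoid (Fin n) => (p.1.classes.ncard, p.2.classes.ncard))
      (fun p _ => Finset.mem_product.2
        ⟨ncard_classes_mem_Icc hn p.1, ncard_classes_mem_Icc hn p.2⟩)]
  refine Finset.sum_congr rfl fun ⟨r, s⟩ _ => ?_
  rw [Finset.sum_congr rfl (g := fun _ => 1 + r * s), Finset.sum_const, smul_eq_mul, mul_comm,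
    joinPairs, ← Set.ncard_coe_finset]
  · congr 2
    ext p
    simp only [Finset.coe_filter, Finset.mem_filter, Finset.mem_univ, true_and, Prod.mk.injEq,
      Set.mem_ofPred_eq]
    tauto
  · rintro p hp
    obtain ⟨rfl, rfl⟩ := Prod.mk.inj (Finset.mem_filter.1 hp).2
    rw [Option.ncard_setOf, ncard_classes, ncard_classes, ← Nat.card_prod]
    simp [partitionMonoid, Set.ncard_univ]

end DiagramPartition

/-! ### Alternating walks of two involutions. -/

/-- Two self-maps act transitively if only the trivial sets are closed under both. -/
def ActTransitively {X : Type*} (σ τ : X → X) : Prop :=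
  ∀ T : Set X, (∀ x ∈ T, σ x ∈ T) → (∀ x ∈ T, τ x ∈ T) → T.Nonempty → T = Set.univ

theorem ActTransitively.swap {X : Type*} {σ τ : X → X} (h : ActTransitively σ τ) :
    ActTransitively τ σ :=
  fun T h₁ h₂ => h T h₂ h₁

/-- The walk that starts at `x` and applies `σ` and `τ` alternately. -/
def alternatingWalk {X : Type*} (σ τ : X → X) (x : X) : ℕ → X
  | 0 => x
  | i + 1 => if Even i then σ (alternatingWalk σ τ x i) else τ (alternatingWalk σ τ x i)

namespace alternatingWalk

variable {X : Type*} {σ τ : X → X} {x : X} {i j m : ℕ}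

theorem succ_of_even (h : Even i) :
    alternatingWalk σ τ x (i + 1) = σ (alternatingWalk σ τ x i) :=
  if_pos h

theorem succ_of_odd (h : Odd i) :
    alternatingWalk σ τ x (i + 1) = τ (alternatingWalk σ τ x i) :=
  if_neg (Nat.not_even_iff_odd.2 h)

theorem apply_succ_of_even (hσ : σ.Involutive) (h : Even i) :
    σ (alternatingWalk σ τ x (i + 1)) = alternatingWalk σ τ x i := by
  rw [succ_of_even h, hσ]

theorem apply_succ_of_odd (hτ : τ.Involutive) (h : Odd i) :
    τ (alternatingWalk σ τ x (i + 1)) = alternatingWalk σ τ x i := by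
  rw [succ_of_odd h, hτ]

/-- Undoing the last step on both sides moves the coincidence to time `m - 1` and a neighbour of
`j`. This contradicts injectivity or parity unless that neighbour would precede the start (`j = 0`)
or is `m` itself (`j + 1 = m`). -/
theorem first_repetition (hσ : σ.Involutive) (hτ : τ.Involutive)
    (hinj : Set.InjOn (alternatingWalk σ τ x) (Set.Iio m)) (hj : j < m)
    (h : alternatingWalk σ τ x m = alternatingWalk σ τ x j) : j + 1 = m ∨ j = 0 ∧ Even m := by
  obtain ⟨m, rfl⟩ : ∃ k, m = k + 1 := ⟨m - 1, by omega⟩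
  by_cases hp : Even m ↔ Even j
  · have h' : alternatingWalk σ τ x m = alternatingWalk σ τ x (j + 1) := by
      rcases Nat.even_or_odd m with hm | hm
      · rw [succ_of_even (hp.1 hm), ← h, apply_succ_of_even hσ hm]
      · have hj : Odd j := by
          rw [← Nat.not_even_iff_odd] at hm ⊢
          rwa [← hp]
        rw [succ_of_odd hj, ← h, apply_succ_of_odd hτ hm]
    by_contra! hne
    have := hinj (Set.mem_Iio.2 (Nat.lt_succ_self m)) (Set.mem_Iio.2 (by omega)) h'
    subst this
    rw [Nat.even_add_one] at hp
    tauto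
  · rcases j with _ | j
    · refine .inr ⟨rfl, ?_⟩
      rw [Nat.even_add_one]
      simpa using hp
    · exfalso
      have h' : alternatingWalk σ τ x m = alternatingWalk σ τ x j := by
        rw [Nat.even_add_one] at hp
        rcases Nat.even_or_odd m with hm | hm
        · rw [← apply_succ_of_even (τ := τ) (x := x) (i := j) hσ (by tauto), ← h,
            apply_succ_of_even hσ hm]
        · have hj : Odd j := by
            rw [← Nat.not_even_iff_odd] at hm ⊢
            tauto
          rw [← apply_succ_of_odd (σ := σ) (x := x) hτ hj, ← h, apply_succ_of_odd hτ hm]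
      have := hinj (Set.mem_Iio.2 (Nat.lt_succ_self m)) (Set.mem_Iio.2 (by omega)) h'
      omega

/-- The ways in which the walk can end after visiting `m` points: by reaching a fixed point when it
started from a fixed point of `τ`, or by closing up. -/
def EndsAt (σ τ : X → X) (x : X) (m : ℕ) : Prop :=
  (τ x = x ∧ alternatingWalk σ τ x m = alternatingWalk σ τ x (m - 1)) ∨
    ((∀ y, σ y ≠ y ∧ τ y ≠ y) ∧ alternatingWalk σ τ x m = x ∧ Even m)

/-- The two images of an interior point are its neighbours on the walk; only the two ends depend on
how the walk stops. -/
theorem EndsAt.image_closed (hσ : σ.Involutive) (hτ : τ.Involutive) (hm : 0 < m)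
    (h : EndsAt σ τ x m) :
    (∀ y ∈ alternatingWalk σ τ x '' Set.Iio m, σ y ∈ alternatingWalk σ τ x '' Set.Iio m) ∧
      ∀ y ∈ alternatingWalk σ τ x '' Set.Iio m, τ y ∈ alternatingWalk σ τ x '' Set.Iio m := by
  have hsucc : ∀ i < m, alternatingWalk σ τ x (i + 1) ∈ alternatingWalk σ τ x '' Set.Iio m := by
    intro i hi
    rcases Nat.lt_or_ge (i + 1) m with h' | h'
    · exact ⟨i + 1, h', rfl⟩
    · obtain rfl : m = i + 1 := by omega
      rcases h with ⟨_, h⟩ | ⟨_, h, _⟩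
      · exact ⟨i, hi, h.symm⟩
      · exact ⟨0, hm, h.symm⟩
  constructor
  · rintro _ ⟨i, hi, rfl⟩
    have hi' : i < m := hi
    rcases Nat.even_or_odd i with he | ho
    · rw [← succ_of_even (σ := σ) (τ := τ) (x := x) he]
      exact hsucc i hi
    · obtain ⟨i, rfl⟩ : ∃ k, i = k + 1 := ⟨i - 1, by have := ho.pos; omega⟩
      rw [apply_succ_of_even hσ (by simpa [Nat.odd_add_one] using ho)]
      exact ⟨i, Set.mem_Iio.2 (by omega), rfl⟩
  · rintro _ ⟨i, hi, rfl⟩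
    have hi' : i < m := hi
    rcases Nat.even_or_odd i with he | ho
    · rcases i with _ | i
      · rcases h with ⟨h, _⟩ | ⟨_, h, he⟩
        · exact ⟨0, hm, h.symm⟩
        · obtain ⟨m, rfl⟩ : ∃ k, m = k + 1 := ⟨m - 1, by omega⟩
          refine ⟨m, Set.mem_Iio.2 (by omega), ?_⟩
          change _ = τ x
          conv_rhs => rw [← h]
          rw [apply_succ_of_odd hτ]
          simpa [Nat.even_add_one] using he
      · rw [apply_succ_of_odd hτ (by simpa [Nat.even_add_one] using he)]
        exact ⟨i, Set.mem_Iio.2 (by omega), rfl⟩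
    · rw [← succ_of_odd (σ := σ) (τ := τ) (x := x) ho]
      exact hsucc i hi

theorem endsAt_of_repetition (hσ : σ.Involutive) (hτ : τ.Involutive)
    (hx : τ x = x ∨ ∀ y, σ y ≠ y ∧ τ y ≠ y)
    (hinj : Set.InjOn (alternatingWalk σ τ x) (Set.Iio m)) (hj : j < m)
    (h : alternatingWalk σ τ x m = alternatingWalk σ τ x j) : EndsAt σ τ x m := by
  rcases hx with hx | hx
  · refine .inl ⟨hx, ?_⟩
    rcases first_repetition hσ hτ hinj hj h with rfl | ⟨rfl, he⟩
    · exact h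
    -- Closing up at a fixed point of `τ` is impossible: undoing the last step would make the walk
    -- return to `x` one step earlier.
    · obtain ⟨m, rfl⟩ : ∃ k, m = k + 1 := ⟨m - 1, by omega⟩
      have ho : Odd m := by simpa [Nat.even_add_one] using he
      have h' : alternatingWalk σ τ x m = alternatingWalk σ τ x 0 := by
        rw [← apply_succ_of_odd hτ ho, h]
        exact hx
      have := hinj (Set.mem_Iio.2 (Nat.lt_succ_self m)) (Set.mem_Iio.2 hj) h'
      subst this
      exact absurd ho (by decide)
  · refine .inr ⟨hx, ?_⟩
    rcases first_repetition hσ hτ hinj hj h with rfl | ⟨rfl, he⟩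
    · rcases Nat.even_or_odd j with hp | hp
      · rw [succ_of_even hp] at h
        exact absurd h (hx _).1
      · rw [succ_of_odd hp] at h
        exact absurd h (hx _).2
    · exact ⟨h, he⟩

variable [Fintype X]

/-- A repetition at a time below the cardinality would make the points visited so far a closed set,
hence all of `X` by transitivity, but they are too few. -/
theorem injOn_of_le_card (hσ : σ.Involutive) (hτ : τ.Involutive) (hc : ActTransitively σ τ)
    (hx : τ x = x ∨ ∀ y, σ y ≠ y ∧ τ y ≠ y) (hm : m ≤ Fintype.card X) :
    Set.InjOn (alternatingWalk σ τ x) (Set.Iio m) := by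
  induction m with
  | zero => simp
  | succ m ih =>
    have ih := ih (by omega)
    have hset : Set.Iio (m + 1) = insert m (Set.Iio m) := by
      ext i
      simp only [Set.mem_Iio, Set.mem_insert_iff]
      omega
    rw [hset, Set.injOn_insert (by simp)]
    refine ⟨ih, ?_⟩
    rintro ⟨j, hj, h⟩
    have hj : j < m := hj
    obtain ⟨h₁, h₂⟩ := EndsAt.image_closed hσ hτ (by omega)
      (endsAt_of_repetition hσ hτ hx ih hj h.symm)
    have hu := hc _ h₁ h₂ ⟨_, j, hj, rfl⟩
    have h3 := ih.ncard_image
    rw [hu, Set.ncard_univ, Nat.card_eq_fintype_card] at h3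
    have h4 : (Set.Iio m).ncard = m := by
      rw [← Finset.coe_Iio, Set.ncard_coe_finset, Nat.card_Iio]
    omega

theorem bijective_fin (hσ : σ.Involutive) (hτ : τ.Involutive) (hc : ActTransitively σ τ)
    (hx : τ x = x ∨ ∀ y, σ y ≠ y ∧ τ y ≠ y) :
    Function.Bijective fun i : Fin (Fintype.card X) => alternatingWalk σ τ x i := by
  rw [Fintype.bijective_iff_injective_and_card]
  exact ⟨fun i j h => Fin.ext (injOn_of_le_card hσ hτ hc hx le_rfl i.2 j.2 h), by simp⟩

theorem endsAt_card (hσ : σ.Involutive) (hτ : τ.Involutive) (hc : ActTransitively σ τ)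
    (hx : τ x = x ∨ ∀ y, σ y ≠ y ∧ τ y ≠ y) : EndsAt σ τ x (Fintype.card X) := by
  obtain ⟨j, hj⟩ := (bijective_fin hσ hτ hc hx).2 (alternatingWalk σ τ x (Fintype.card X))
  exact endsAt_of_repetition hσ hτ hx (injOn_of_le_card hσ hτ hc hx le_rfl) j.2 hj.symm

end alternatingWalk

/-! ### Model paths and cycles, and labellings by them. -/

/-- The involution of `{0, …, n - 1}` that swaps `i` and `i + 1` for all `i` with `i % 2 = c`. -/
def pathStep (n c : ℕ) (i : Fin n) : Fin n :=
  -- For `c = 1` the truncated subtraction makes `0` a fixed point, the start of the path.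
  ⟨if (i : ℕ) % 2 = c then (if (i : ℕ) + 1 < n then i + 1 else i) else i - 1, by
    have := i.2
    split_ifs <;> omega⟩

/-- The involution of `{0, …, n - 1}`, for even `n`, that swaps `i` and `i + 1` modulo `n` for all
odd `i`. -/
def cycleStep (n : ℕ) (i : Fin n) : Fin n :=
  ⟨if (i : ℕ) % 2 = 1 then (if (i : ℕ) + 1 < n then i + 1 else 0) else
    (if (i : ℕ) = 0 then n - 1 else i - 1), by
    have := i.2
    split_ifs <;> omega⟩

theorem pathStep_involutive {n c : ℕ} (hc : c < 2) : (pathStep n c).Involutive := by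
  intro i
  have := i.2
  ext
  simp only [pathStep]
  split_ifs <;> omega

theorem cycleStep_involutive {n : ℕ} (hn : Even n) : (cycleStep n).Involutive := by
  rw [Nat.even_iff] at hn
  intro i
  have := i.2
  ext
  simp only [cycleStep]
  split_ifs <;> first | omega | contradiction

/-- The involutions of a type. -/
abbrev InvolutiveMap (X : Type*) := {σ : X → X // σ.Involutive}

/-- The transport of an involution along a bijection. -/
def InvolutiveMap.conj {X Y : Type*} (f : Y ≃ X) (s : InvolutiveMap Y) : InvolutiveMap X :=
  ⟨fun x => f (s.1 (f.symm x)), fun x => by simp [s.2 (f.symm x)]⟩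

theorem InvolutiveMap.conj_eq_iff {X Y : Type*} {f : Y ≃ X} {s : InvolutiveMap Y}
    {σ : InvolutiveMap X} : s.conj f = σ ↔ ∀ i, σ.1 (f i) = f (s.1 i) := by
  constructor
  · rintro rfl i
    simp [conj]
  · intro h
    refine Subtype.ext (funext fun x => ?_)
    rw [← f.apply_symm_apply x, h]
    simp [conj]

section Labelling

variable {X : Type*} {n : ℕ} {σ τ : X → X} {s t : Fin n → Fin n} {f : Fin n → X}

/-- A labelling compatible with both involutions is determined by the point labelled `0`; this gives
injectivity in the counts of labellings. -/
theorem labelling_eq_walk (hs : ∀ i j : Fin n, (j : ℕ) = i + 1 → Even (i : ℕ) → s i = j)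
    (ht : ∀ i j : Fin n, (j : ℕ) = i + 1 → Odd (i : ℕ) → t i = j)
    (hσ : ∀ i, σ (f i) = f (s i)) (hτ : ∀ i, τ (f i) = f (t i)) (hn : 0 < n) (i : Fin n) :
    f i = alternatingWalk σ τ (f ⟨0, hn⟩) i := by
  obtain ⟨i, hi⟩ := i
  induction i with
  | zero => rfl
  | succ i ih =>
    have ih := ih (by omega)
    rcases Nat.even_or_odd i with h | h
    · rw [alternatingWalk.succ_of_even h, ← ih, hσ, hs _ ⟨i + 1, hi⟩ rfl h]
    · rw [alternatingWalk.succ_of_odd h, ← ih, hτ, ht _ ⟨i + 1, hi⟩ rfl h]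

theorem actTransitively_of_labelling
    (hs : ∀ i j : Fin n, (j : ℕ) = i + 1 → Even (i : ℕ) → s i = j)
    (ht : ∀ i j : Fin n, (j : ℕ) = i + 1 → Odd (i : ℕ) → t i = j)
    (hσi : σ.Involutive) (hτi : τ.Involutive)
    (hσ : ∀ i, σ (f i) = f (s i)) (hτ : ∀ i, τ (f i) = f (t i)) (hf : f.Surjective) :
    ActTransitively σ τ := by
  intro T h₁ h₂ hT
  have hσT : ∀ x, σ x ∈ T ↔ x ∈ T := fun x => ⟨fun h => hσi x ▸ h₁ _ h, h₁ x⟩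
  have hτT : ∀ x, τ x ∈ T ↔ x ∈ T := fun x => ⟨fun h => hτi x ▸ h₂ _ h, h₂ x⟩
  have key : ∀ i (hi : i < n), f ⟨i, hi⟩ ∈ T ↔ f ⟨0, by omega⟩ ∈ T := by
    intro i hi
    induction i with
    | zero => rfl
    | succ i ih =>
      rw [← ih (by omega)]
      rcases Nat.even_or_odd i with h | h
      · rw [← hs ⟨i, by omega⟩ ⟨i + 1, hi⟩ rfl h, ← hσ, hσT]
      · rw [← ht ⟨i, by omega⟩ ⟨i + 1, hi⟩ rfl h, ← hτ, hτT]
  obtain ⟨x, hx⟩ := hT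
  obtain ⟨i, rfl⟩ := hf x
  refine Set.eq_univ_of_forall fun y => ?_
  obtain ⟨j, rfl⟩ := hf y
  exact (key j j.2).2 ((key i i.2).1 hx)

end Labelling

theorem pathStep_zero_of_even {n : ℕ} (i j : Fin n) (h : (j : ℕ) = i + 1) (he : Even (i : ℕ)) :
    pathStep n 0 i = j := by
  rw [Nat.even_iff] at he
  ext
  simp [pathStep, he, ← h]

theorem pathStep_one_of_odd {n : ℕ} (i j : Fin n) (h : (j : ℕ) = i + 1) (ho : Odd (i : ℕ)) :
    pathStep n 1 i = j := by
  rw [Nat.odd_iff] at ho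
  ext
  simp [pathStep, ho, ← h]

theorem cycleStep_of_odd {n : ℕ} (i j : Fin n) (h : (j : ℕ) = i + 1) (ho : Odd (i : ℕ)) :
    cycleStep n i = j := by
  rw [Nat.odd_iff] at ho
  ext
  simp [cycleStep, ho, ← h]

section Existence

variable {X : Type*} [Fintype X] {n : ℕ} {σ τ : X → X} {x : X}

open alternatingWalk

theorem exists_path_labelling (hn : Fintype.card X = n) (hσ : σ.Involutive) (hτ : τ.Involutive)
    (hc : ActTransitively σ τ) (hx : τ x = x) (h0 : 0 < n) :
    ∃ f : Fin n ≃ X, f ⟨0, h0⟩ = x ∧ (∀ i, σ (f i) = f (pathStep n 0 i)) ∧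
      ∀ i, τ (f i) = f (pathStep n 1 i) := by
  subst hn
  have hend := endsAt_card hσ hτ hc (.inl hx)
  have hend : alternatingWalk σ τ x (Fintype.card X) =
      alternatingWalk σ τ x (Fintype.card X - 1) := by
    rcases hend with h | h
    exacts [h.2, absurd hx (h.1 x).2]
  refine ⟨Equiv.ofBijective _ (bijective_fin hσ hτ hc (.inl hx)), rfl, ?_, ?_⟩
  all_goals
    rintro ⟨i, hi⟩
    simp only [Equiv.ofBijective_apply, pathStep]
  · split_ifs with h1 h2
    · rw [succ_of_even (Nat.even_iff.2 h1)]
    · rw [← succ_of_even (σ := σ) (τ := τ) (x := x) (Nat.even_iff.2 h1)]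
      obtain rfl : i = Fintype.card X - 1 := by omega
      rwa [Nat.sub_add_cancel (by omega)]
    · obtain ⟨i, rfl⟩ : ∃ k, i = k + 1 := ⟨i - 1, by omega⟩
      exact apply_succ_of_even hσ (Nat.even_iff.2 (by omega))
  · split_ifs with h1 h2
    · rw [succ_of_odd (Nat.odd_iff.2 h1)]
    · rw [← succ_of_odd (σ := σ) (τ := τ) (x := x) (Nat.odd_iff.2 h1)]
      obtain rfl : i = Fintype.card X - 1 := by omega
      rwa [Nat.sub_add_cancel (by omega)]
    · rcases i with _ | i
      · exact hx
      · exact apply_succ_of_odd hτ (Nat.odd_iff.2 (by omega))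

theorem even_card_of_no_fixed_points (hn : Fintype.card X = n) (hσ : σ.Involutive)
    (hτ : τ.Involutive) (hc : ActTransitively σ τ) (hx : ∀ y, σ y ≠ y ∧ τ y ≠ y) (h0 : 0 < n) :
    Even n := by
  subst hn
  obtain ⟨x⟩ := Fintype.card_pos_iff.1 h0
  rcases endsAt_card (x := x) hσ hτ hc (.inr hx) with h | h
  exacts [absurd h.1 (hx x).2, h.2.2]

theorem exists_cycle_labelling (hn : Fintype.card X = n) (hσ : σ.Involutive) (hτ : τ.Involutive)
    (hc : ActTransitively σ τ) (hx : ∀ y, σ y ≠ y ∧ τ y ≠ y) (h0 : 0 < n) (x : X) :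
    ∃ f : Fin n ≃ X, f ⟨0, h0⟩ = x ∧ (∀ i, σ (f i) = f (pathStep n 0 i)) ∧
      ∀ i, τ (f i) = f (cycleStep n i) := by
  have he := even_card_of_no_fixed_points hn hσ hτ hc hx h0
  rw [Nat.even_iff] at he
  subst hn
  have hend : alternatingWalk σ τ x (Fintype.card X) = x := by
    rcases endsAt_card (x := x) hσ hτ hc (.inr hx) with h | h
    exacts [absurd h.1 (hx x).2, h.2.1]
  refine ⟨Equiv.ofBijective _ (bijective_fin hσ hτ hc (.inr hx)), rfl, ?_, ?_⟩
  all_goals rintro ⟨i, hi⟩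
  · simp only [Equiv.ofBijective_apply, pathStep]
    split_ifs with h1 h2
    · rw [succ_of_even (Nat.even_iff.2 h1)]
    · omega
    · obtain ⟨i, rfl⟩ : ∃ k, i = k + 1 := ⟨i - 1, by omega⟩
      exact apply_succ_of_even hσ (Nat.even_iff.2 (by omega))
  · simp only [Equiv.ofBijective_apply, cycleStep]
    split_ifs with h1 h2 h3
    · rw [succ_of_odd (Nat.odd_iff.2 h1)]
    · rw [← succ_of_odd (σ := σ) (τ := τ) (x := x) (Nat.odd_iff.2 h1)]
      obtain rfl : i = Fintype.card X - 1 := by omega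
      rwa [Nat.sub_add_cancel (by omega)]
    · subst h3
      change τ x = _
      conv_lhs => rw [← hend]
      obtain ⟨k, hk⟩ : ∃ k, Fintype.card X = k + 1 := ⟨Fintype.card X - 1, by omega⟩
      rw [hk, apply_succ_of_odd hτ (Nat.odd_iff.2 (by omega)), Nat.add_sub_cancel]
    · obtain ⟨i, rfl⟩ : ∃ k, i = k + 1 := ⟨i - 1, by omega⟩
      exact apply_succ_of_odd hτ (Nat.odd_iff.2 (by omega))

/-- Without fixed points the number of points would be even. Otherwise the roles can be swapped so
that `τ` has one; on the resulting path the last index `n - 1` is even, so that end is fixed by `σ`.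
-/
theorem existsUnique_fixed_points_of_odd (hn : Fintype.card X = n) (hσ : σ.Involutive)
    (hτ : τ.Involutive) (hc : ActTransitively σ τ) (ho : Odd n) :
    (∃ x, ∀ y, σ y = y ↔ y = x) ∧ ∃ x, ∀ y, τ y = y ↔ y = x := by
  have key : ∀ {σ τ : X → X}, σ.Involutive → τ.Involutive → ActTransitively σ τ →
      (∃ x, τ x = x) → (∃ x, ∀ y, σ y = y ↔ y = x) ∧ ∃ x, ∀ y, τ y = y ↔ y = x := by
    rintro σ τ hσ hτ hc ⟨x, hx⟩
    obtain ⟨f, -, h1, h2⟩ := exists_path_labelling hn hσ hτ hc hx ho.pos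
    rw [Nat.odd_iff] at ho
    refine ⟨⟨f ⟨n - 1, by omega⟩, ?_⟩, ⟨f ⟨0, by omega⟩, ?_⟩⟩
    all_goals
      intro y
      obtain ⟨i, rfl⟩ := f.surjective y
      have := i.2
      simp only [h1, h2, f.apply_eq_iff_eq, pathStep, Fin.ext_iff]
      split_ifs <;> omega
  by_cases h : ∃ x, τ x = x
  · exact key hσ hτ hc h
  · by_cases h' : ∃ x, σ x = x
    · exact (key hτ hσ hc.swap h').symm
    · push Not at h h'
      exact absurd (even_card_of_no_fixed_points hn hσ hτ hc (fun y => ⟨h' y, h y⟩) ho.pos)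
        (Nat.not_even_iff_odd.2 ho)

/-- Here the last index `n - 1` is odd, so `τ` fixes both ends of the path. -/
theorem fixed_points_of_even (hn : Fintype.card X = n) (hσ : σ.Involutive)
    (hτ : τ.Involutive) (hc : ActTransitively σ τ) (he : Even n) (hx : τ x = x) :
    (∀ y, σ y ≠ y) ∧ {y | τ y = y}.ncard = 2 := by
  have h0 : 0 < n := hn ▸ Fintype.card_pos_iff.2 ⟨x⟩
  obtain ⟨f, -, h1, h2⟩ := exists_path_labelling hn hσ hτ hc hx h0
  rw [Nat.even_iff] at he
  constructor
  · intro y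
    obtain ⟨i, rfl⟩ := f.surjective y
    have := i.2
    simp only [h1, Ne, f.apply_eq_iff_eq, pathStep, Fin.ext_iff]
    split_ifs <;> omega
  · rw [Set.ncard_eq_two]
    refine ⟨f ⟨0, h0⟩, f ⟨n - 1, by omega⟩, ?_, ?_⟩
    · simp only [Ne, f.apply_eq_iff_eq, Fin.ext_iff]
      omega
    · ext y
      obtain ⟨i, rfl⟩ := f.surjective y
      have := i.2
      simp only [Set.mem_ofPred_eq, Set.mem_insert_iff, Set.mem_singleton_iff, h2,
        f.apply_eq_iff_eq, pathStep, Fin.ext_iff]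
      split_ifs <;> omega

end Existence

/-! ### Counting transitive pairs of involutions. -/

section Count

variable {X : Type*} [Fintype X] [DecidableEq X] [Fintype (InvolutiveMap X)] {n : ℕ}

-- Double counting of bijections `Fin n ≃ X`: each transports the model path to a transitive pair,
-- and the labellings of a given pair correspond to the fixed points of `τ`, via the image of `0`.
open Classical in
theorem sum_ncard_fixed_points_right (hn : Fintype.card X = n) (h0 : 0 < n) :
    ∑ p : InvolutiveMap X × InvolutiveMap X with ActTransitively p.1.1 p.2.1,
      {x | p.2.1 x = x}.ncard = n.factorial := by
  have hcard : Fintype.card (Fin n ≃ X) = n.factorial := by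
    rw [Fintype.card_equiv (Fintype.equivFinOfCardEq hn).symm, Fintype.card_fin]
  let s : InvolutiveMap (Fin n) := ⟨pathStep n 0, pathStep_involutive (by norm_num)⟩
  let t : InvolutiveMap (Fin n) := ⟨pathStep n 1, pathStep_involutive (by norm_num)⟩
  rw [← hcard, ← Finset.card_univ,
    Finset.card_eq_sum_card_fiberwise (f := fun f : Fin n ≃ X => (s.conj f, t.conj f))
      (t := Finset.univ.filter fun p : InvolutiveMap X × InvolutiveMap X =>
        ActTransitively p.1.1 p.2.1)]
  · refine Finset.sum_congr rfl fun p hp => ?_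
    have hp := (Finset.mem_filter.1 hp).2
    rw [← Set.ncard_coe_finset]
    symm
    refine Set.BijOn.ncard_eq (f := fun f : Fin n ≃ X => f ⟨0, h0⟩) ⟨?_, ?_, ?_⟩
    all_goals simp only [Finset.coe_filter, Finset.mem_univ, true_and, Prod.ext_iff,
      InvolutiveMap.conj_eq_iff]
    · rintro f ⟨_, h2⟩
      exact (h2 _).trans (congrArg f (Fin.ext (by simp [t, pathStep])))
    · rintro f ⟨h1, h2⟩ g ⟨h1', h2'⟩ hfg
      refine Equiv.ext fun i => ?_
      rw [labelling_eq_walk pathStep_zero_of_even pathStep_one_of_odd h1 h2 h0 i,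
        labelling_eq_walk pathStep_zero_of_even pathStep_one_of_odd h1' h2' h0 i]
      exact congrArg (fun x => alternatingWalk p.1.1 p.2.1 x i) hfg
    · intro x hx
      obtain ⟨f, hf, h1, h2⟩ := exists_path_labelling hn p.1.2 p.2.2 hp hx h0
      exact ⟨f, ⟨h1, h2⟩, hf⟩
  · intro f _
    simp only [Finset.coe_filter, Finset.mem_univ, true_and]
    exact actTransitively_of_labelling pathStep_zero_of_even pathStep_one_of_odd (s.conj f).2
      (t.conj f).2 (InvolutiveMap.conj_eq_iff.1 rfl) (InvolutiveMap.conj_eq_iff.1 rfl) f.surjective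

open Classical in
theorem sum_ncard_fixed_points_left (hn : Fintype.card X = n) (h0 : 0 < n) :
    ∑ p : InvolutiveMap X × InvolutiveMap X with ActTransitively p.1.1 p.2.1,
      {x | p.1.1 x = x}.ncard = n.factorial := by
  rw [← sum_ncard_fixed_points_right hn h0]
  exact Finset.sum_nbij' Prod.swap Prod.swap
    (fun p hp => by simpa using (Finset.mem_filter.1 hp).2.swap)
    (fun p hp => by simpa using (Finset.mem_filter.1 hp).2.swap)
    (fun _ _ => rfl) (fun _ _ => rfl) (fun _ _ => rfl)

open Classical in
theorem card_actTransitively_of_odd (hn : Fintype.card X = n) (ho : Odd n) :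
    (Finset.univ.filter fun p : InvolutiveMap X × InvolutiveMap X =>
      ActTransitively p.1.1 p.2.1).card = n.factorial := by
  rw [← sum_ncard_fixed_points_right hn ho.pos, Finset.card_eq_sum_ones]
  refine Finset.sum_congr rfl fun p hp => ?_
  obtain ⟨-, x, hx⟩ :=
    existsUnique_fixed_points_of_odd hn p.1.2 p.2.2 (Finset.mem_filter.1 hp).2 ho
  simp [hx]

-- A path has two fixed points, both of the same involution, and a cycle has none. Summing the fixed
-- points of both involutions therefore counts each path twice.
open Classical in
theorem card_actTransitively_with_fixed_point (hn : Fintype.card X = n) (h0 : 0 < n)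
    (he : Even n) :
    (Finset.univ.filter fun p : InvolutiveMap X × InvolutiveMap X =>
      ActTransitively p.1.1 p.2.1 ∧ ¬ ∀ x, p.1.1 x ≠ x ∧ p.2.1 x ≠ x).card = n.factorial := by
  have h : ∑ p : InvolutiveMap X × InvolutiveMap X with ActTransitively p.1.1 p.2.1,
      ({x | p.1.1 x = x}.ncard + {x | p.2.1 x = x}.ncard) = 2 * n.factorial := by
    rw [Finset.sum_add_distrib, sum_ncard_fixed_points_left hn h0,
      sum_ncard_fixed_points_right hn h0, two_mul]
  refine Nat.eq_of_mul_eq_mul_left (Nat.two_pos) (Eq.trans ?_ h)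
  rw [← Finset.filter_filter, Finset.card_filter, Finset.mul_sum]
  refine Finset.sum_congr rfl fun p hp => ?_
  have hp := (Finset.mem_filter.1 hp).2
  by_cases h2 : ∃ x, p.2.1 x = x
  · obtain ⟨x, hx⟩ := h2
    obtain ⟨h1, h2⟩ := fixed_points_of_even hn p.1.2 p.2.2 hp he hx
    rw [h2, if_pos fun h => (h x).2 hx]
    simp [h1]
  by_cases h1 : ∃ x, p.1.1 x = x
  · obtain ⟨x, hx⟩ := h1
    obtain ⟨h1, h2⟩ := fixed_points_of_even hn p.2.2 p.1.2 hp.swap he hx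
    rw [h2, if_pos fun h => (h x).1 hx]
    simp [h1]
  · push Not at h1 h2
    simp [h1, h2]

-- Any point of a cycle may be labelled `0`, so each pair has exactly `n` labellings among the `n!`
-- bijections.
open Classical in
theorem card_actTransitively_without_fixed_points (hn : Fintype.card X = n) (h0 : 0 < n)
    (he : Even n) :
    (Finset.univ.filter fun p : InvolutiveMap X × InvolutiveMap X =>
      ActTransitively p.1.1 p.2.1 ∧ ∀ x, p.1.1 x ≠ x ∧ p.2.1 x ≠ x).card =
        (n - 1).factorial := by
  have hcard : Fintype.card (Fin n ≃ X) = n.factorial := by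
    rw [Fintype.card_equiv (Fintype.equivFinOfCardEq hn).symm, Fintype.card_fin]
  let s : InvolutiveMap (Fin n) := ⟨pathStep n 0, pathStep_involutive (by norm_num)⟩
  let t : InvolutiveMap (Fin n) := ⟨cycleStep n, cycleStep_involutive he⟩
  refine Nat.eq_of_mul_eq_mul_right h0 ?_
  rw [mul_comm _ n, mul_comm _ n, Nat.mul_factorial_pred h0.ne', ← hcard, ← Finset.card_univ,
    Finset.card_eq_sum_card_fiberwise (f := fun f : Fin n ≃ X => (s.conj f, t.conj f))
      (t := Finset.univ.filter fun p : InvolutiveMap X × InvolutiveMap X =>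
        ActTransitively p.1.1 p.2.1 ∧ ∀ x, p.1.1 x ≠ x ∧ p.2.1 x ≠ x),
    mul_comm, ← smul_eq_mul, ← Finset.sum_const]
  · refine Finset.sum_congr rfl fun p hp => ?_
    obtain ⟨hp, hx⟩ := (Finset.mem_filter.1 hp).2
    rw [← Set.ncard_coe_finset]
    have hu : n = (Set.univ : Set X).ncard := by
      rw [Set.ncard_univ, Nat.card_eq_fintype_card, hn]
    conv_lhs => rw [hu]
    symm
    refine Set.BijOn.ncard_eq (f := fun f : Fin n ≃ X => f ⟨0, h0⟩) ⟨?_, ?_, ?_⟩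
    all_goals simp only [Finset.coe_filter, Finset.mem_univ, true_and, Prod.ext_iff,
      InvolutiveMap.conj_eq_iff]
    · exact fun _ _ => trivial
    · rintro f ⟨h1, h2⟩ g ⟨h1', h2'⟩ hfg
      refine Equiv.ext fun i => ?_
      rw [labelling_eq_walk pathStep_zero_of_even cycleStep_of_odd h1 h2 h0 i,
        labelling_eq_walk pathStep_zero_of_even cycleStep_of_odd h1' h2' h0 i]
      exact congrArg (fun x => alternatingWalk p.1.1 p.2.1 x i) hfg
    · intro x _
      obtain ⟨f, hf, h1, h2⟩ := exists_cycle_labelling hn p.1.2 p.2.2 hp hx h0 x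
      exact ⟨f, ⟨h1, h2⟩, hf⟩
  · intro f _
    simp only [Finset.coe_filter, Finset.mem_univ, true_and]
    have h1 := InvolutiveMap.conj_eq_iff.1 (rfl : s.conj f = s.conj f)
    have h2 := InvolutiveMap.conj_eq_iff.1 (rfl : t.conj f = t.conj f)
    refine ⟨actTransitively_of_labelling pathStep_zero_of_even cycleStep_of_odd (s.conj f).2
      (t.conj f).2 h1 h2 f.surjective, fun x => ?_⟩
    obtain ⟨i, rfl⟩ := f.surjective x
    have := i.2
    rw [Nat.even_iff] at he
    simp only [h1, h2, Ne, f.apply_eq_iff_eq, s, t, pathStep, cycleStep, Fin.ext_iff]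
    constructor <;> split_ifs <;> omega

end Count

/-! ### Equivalence relations with classes of size at most two as involutions. -/

namespace InvolutiveMap

variable {X : Type*} {σ τ : InvolutiveMap X} {x y : X}

/-- The equivalence relation whose classes are the orbits of an involution. -/
def orbitRel (σ : InvolutiveMap X) : Setoid X where
  r x y := y = x ∨ y = σ.1 x
  iseqv :=
    { refl := fun x => .inl rfl
      symm := by
        rintro x _ (rfl | rfl)
        exacts [.inl rfl, .inr (σ.2 x).symm]
      trans := by
        rintro x _ _ (rfl | rfl) (rfl | rfl)
        exacts [.inl rfl, .inr rfl, .inr rfl, .inl (σ.2 x)] }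

theorem orbitRel_iff : σ.orbitRel x y ↔ y = x ∨ y = σ.1 x := Iff.rfl

theorem setOf_orbitRel (x : X) : {y | σ.orbitRel y x} = {x, σ.1 x} := by
  ext y
  rw [Set.mem_ofPred_eq, Setoid.comm', orbitRel_iff, Set.mem_insert_iff, Set.mem_singleton_iff]

theorem encard_orbit_of_fixed (h : σ.1 x = x) : {y | σ.orbitRel y x}.encard = 1 := by
  rw [setOf_orbitRel, h, Set.pair_eq_singleton, Set.encard_singleton]

theorem encard_orbit_of_not_fixed (h : σ.1 x ≠ x) : {y | σ.orbitRel y x}.encard = 2 := by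
  rw [setOf_orbitRel, Set.encard_pair h.symm]

theorem encard_orbit_le_two (σ : InvolutiveMap X) (x : X) : {y | σ.orbitRel y x}.encard ≤ 2 := by
  by_cases h : σ.1 x = x
  · rw [encard_orbit_of_fixed h]
    norm_num
  · rw [encard_orbit_of_not_fixed h]

theorem orbitRel_injective : Function.Injective (orbitRel (X := X)) := by
  intro σ τ h
  refine Subtype.ext (funext fun x => ?_)
  have h1 : τ.orbitRel x (σ.1 x) := h ▸ .inr rfl
  have h2 : σ.orbitRel x (τ.1 x) := h ▸ .inr rfl
  rcases h1 with h1 | h1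
  · rcases h2 with h2 | h2
    exacts [h1.trans h2.symm, h2.symm]
  · exact h1

/-- The involution sends a point to the other member of its class, or to itself if there is none. -/
theorem exists_orbitRel_eq {ε : Setoid X} (h : ∀ x, {y | ε y x}.encard ≤ 2) :
    ∃ σ : InvolutiveMap X, σ.orbitRel = ε := by
  classical
  have huniq : ∀ {x y z}, ε x y → ε x z → y ≠ x → z ≠ x → y = z := by
    intro x y z hy hz hyx hzx
    by_contra hyz
    have h3 : ({x, y, z} : Set X).encard = 3 :=
      Set.encard_eq_three.2 ⟨x, y, z, hyx.symm, hzx.symm, hyz, rfl⟩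
    have hsub : ({x, y, z} : Set X) ⊆ {y | ε y x} := by
      rintro _ (rfl | rfl | rfl)
      exacts [ε.refl' _, ε.symm' hy, ε.symm' hz]
    have := (Set.encard_le_encard hsub).trans (h x)
    rw [h3] at this
    exact absurd this (by decide)
  let s : X → X := fun x => if h : ∃ y, y ≠ x ∧ ε x y then h.choose else x
  have hs : ∀ x y, y ≠ x → ε x y → s x = y := by
    intro x y hyx hxy
    have h : ∃ y, y ≠ x ∧ ε x y := ⟨y, hyx, hxy⟩
    have hsx : s x = h.choose := dif_pos h
    rw [hsx]
    exact huniq h.choose_spec.2 hxy h.choose_spec.1 hyx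
  have hs' : ∀ x, ε x (s x) := by
    intro x
    by_cases h : ∃ y, y ≠ x ∧ ε x y
    · have hsx : s x = h.choose := dif_pos h
      exact hsx ▸ h.choose_spec.2
    · have hsx : s x = x := dif_neg h
      exact hsx.symm ▸ ε.refl' x
  refine ⟨⟨s, fun x => ?_⟩, Setoid.ext fun x y => ⟨?_, fun hxy => ?_⟩⟩
  · by_cases h : s x = x
    · rw [h, h]
    · exact hs _ _ (Ne.symm h) (ε.symm' (hs' x))
  · rintro (rfl | rfl)
    exacts [ε.refl' _, hs' x]
  · by_cases h : y = x
    exacts [.inl h, .inr (hs x y h hxy).symm]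

theorem orbitRel_sup_eq_top [Nonempty X] :
    σ.orbitRel ⊔ τ.orbitRel = ⊤ ↔ ActTransitively σ.1 τ.1 := by
  constructor
  · rintro h T hσ hτ ⟨x, hx⟩
    refine Set.eq_univ_of_forall fun y => ?_
    have hxy : (σ.orbitRel ⊔ τ.orbitRel) x y := by
      rw [h]
      trivial
    refine (Setoid.mem_iff_of_sup (T := fun x => x ∈ T) ?_ ?_ hxy).1 hx
    · rintro x _ (rfl | rfl) hx
      exacts [hx, hσ _ hx]
    · rintro x _ (rfl | rfl) hx
      exacts [hx, hτ _ hx]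
  · intro h
    rw [Setoid.eq_top_iff]
    intro x y
    have hT := h {y | (σ.orbitRel ⊔ τ.orbitRel) x y}
      (fun y hy => Setoid.trans' _ hy
        ((le_sup_left : σ.orbitRel ≤ σ.orbitRel ⊔ τ.orbitRel) (orbitRel_iff.2 (.inr rfl))))
      (fun y hy => Setoid.trans' _ hy
        ((le_sup_right : τ.orbitRel ≤ σ.orbitRel ⊔ τ.orbitRel) (orbitRel_iff.2 (.inr rfl))))
      ⟨x, Setoid.refl' (σ.orbitRel ⊔ τ.orbitRel) x⟩
    exact Set.eq_univ_iff_forall.1 hT y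

end InvolutiveMap

/-! ### Block sizes and the counts for `B_n` and `PB_n`. -/

namespace DiagramPartition

variable {X : Type*}

theorem _root_.Set.encard_sum {Y : Type*} (S : Set (X ⊕ Y)) :
    S.encard = (Sum.inl ⁻¹' S).encard + (Sum.inr ⁻¹' S).encard := by
  rw [← Sum.inl_injective.encard_image (Sum.inl ⁻¹' S),
    ← Sum.inr_injective.encard_image (Sum.inr ⁻¹' S), ← Set.encard_union_eq, Set.image_preimage_inl_union_image_preimage_inr]
  rw [Set.disjoint_left]
  rintro _ ⟨a, _, rfl⟩ ⟨b, _, h⟩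
  cases h

section Block

variable {ε η : Setoid X} {o : Option (Quotient ε × Quotient η)}

theorem encard_block_inl (x : X) :
    {v | (ofKernels ε η o).Rel v (.inl x)}.encard =
      {z | ε z x}.encard + {y | o = some (Quotient.mk ε x, Quotient.mk η y)}.encard := by
  rw [Set.encard_sum]
  congr 2
  · ext z
    exact ofKernels_upper
  · ext z
    exact Rel.comm.trans ofKernels_transversal

theorem encard_block_inr (y : X) :
    {v | (ofKernels ε η o).Rel v (.inr y)}.encard =
      {x | o = some (Quotient.mk ε x, Quotient.mk η y)}.encard + {z | η z y}.encard := by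
  rw [Set.encard_sum]
  congr 2
  · ext z
    exact ofKernels_transversal
  · ext z
    exact ofKernels_lower

theorem ofKernels_mem_blockMonoid {P : ℕ∞ → Prop} :
    ofKernels ε η o ∈ blockMonoid P X ↔
      (∀ x, P ({z | ε z x}.encard +
        {y | o = some (Quotient.mk ε x, Quotient.mk η y)}.encard)) ∧
      ∀ y, P ({x | o = some (Quotient.mk ε x, Quotient.mk η y)}.encard +
        {z | η z y}.encard) := by
  rw [mem_blockMonoid]
  simp_rw [← encard_block_inl, ← encard_block_inr]
  exact Sum.forall

theorem encard_transversal_of_rel {a b x : X} (h : ε a x) :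
    {y | some (Quotient.mk ε a, Quotient.mk η b) =
      some (Quotient.mk ε x, Quotient.mk η y)}.encard = {z | η z b}.encard := by
  congr 1
  ext y
  simp only [Set.mem_ofPred_eq, Option.some_inj, Prod.mk.injEq, Quotient.eq]
  exact ⟨fun h' => Setoid.symm' _ h'.2, fun h' => ⟨h, Setoid.symm' _ h'⟩⟩

theorem encard_transversal_of_rel' {a b y : X} (h : η b y) :
    {x | some (Quotient.mk ε a, Quotient.mk η b) =
      some (Quotient.mk ε x, Quotient.mk η y)}.encard = {z | ε z a}.encard := by
  congr 1
  ext x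
  simp only [Set.mem_ofPred_eq, Option.some_inj, Prod.mk.injEq, Quotient.eq]
  exact ⟨fun h' => Setoid.symm' _ h'.1, fun h' => ⟨Setoid.symm' _ h', h⟩⟩

theorem encard_transversal_of_not_rel {a b x : X} (h : ¬ ε a x) :
    {y | some (Quotient.mk ε a, Quotient.mk η b) =
      some (Quotient.mk ε x, Quotient.mk η y)}.encard = 0 := by
  rw [Set.encard_eq_zero, Set.eq_empty_iff_forall_notMem]
  simp only [Set.mem_ofPred_eq, Option.some_inj, Prod.mk.injEq, Quotient.eq]
  exact fun y h' => h h'.1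

theorem encard_transversal_of_not_rel' {a b y : X} (h : ¬ η b y) :
    {x | some (Quotient.mk ε a, Quotient.mk η b) =
      some (Quotient.mk ε x, Quotient.mk η y)}.encard = 0 := by
  rw [Set.encard_eq_zero, Set.eq_empty_iff_forall_notMem]
  simp only [Set.mem_ofPred_eq, Option.some_inj, Prod.mk.injEq, Quotient.eq]
  exact fun x h' => h h'.2

end Block

theorem partialBrauerMonoid_eq_blockMonoid :
    partialBrauerMonoid X = blockMonoid (· ≤ 2) X := rfl

theorem brauerMonoid_eq_blockMonoid : brauerMonoid X = blockMonoid (· = 2) X := rfl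

theorem brauerMonoid_subset_partialBrauerMonoid : brauerMonoid X ⊆ partialBrauerMonoid X :=
  fun _ h A hA => (h A hA).le

theorem exists_orbitRel_eq_of_ofKernels_mem {ε η : Setoid X}
    {o : Option (Quotient ε × Quotient η)} (h : ofKernels ε η o ∈ partialBrauerMonoid X) :
    ∃ σ τ : InvolutiveMap X, σ.orbitRel = ε ∧ τ.orbitRel = η := by
  rw [partialBrauerMonoid_eq_blockMonoid, ofKernels_mem_blockMonoid] at h
  obtain ⟨σ, hσ⟩ := InvolutiveMap.exists_orbitRel_eq fun x => le_self_add.trans (h.1 x)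
  obtain ⟨τ, hτ⟩ := InvolutiveMap.exists_orbitRel_eq fun x => le_add_self.trans (h.2 x)
  exact ⟨σ, τ, hσ, hτ⟩

section Involution

open InvolutiveMap

variable {σ τ : InvolutiveMap X}

theorem ofKernels_none_mem_partialBrauerMonoid :
    ofKernels σ.orbitRel τ.orbitRel none ∈ partialBrauerMonoid X := by
  rw [partialBrauerMonoid_eq_blockMonoid, ofKernels_mem_blockMonoid]
  simp [encard_orbit_le_two]

theorem ofKernels_none_mem_brauerMonoid :
    ofKernels σ.orbitRel τ.orbitRel none ∈ brauerMonoid X ↔ ∀ x, σ.1 x ≠ x ∧ τ.1 x ≠ x := by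
  rw [brauerMonoid_eq_blockMonoid, ofKernels_mem_blockMonoid, forall_and]
  have key : ∀ (σ : InvolutiveMap X) x, {y | σ.orbitRel y x}.encard = 2 ↔ σ.1 x ≠ x := by
    refine fun σ x => ⟨fun h hx => ?_, encard_orbit_of_not_fixed⟩
    rw [encard_orbit_of_fixed hx] at h
    exact absurd h (by decide)
  simp [key]

/-- The transversal block is the union of the upper orbit of `a` and the lower orbit of `b`, so it
has size at most two only if both are singletons. -/
theorem ofKernels_some_mem_partialBrauerMonoid {a b : X} :
    ofKernels σ.orbitRel τ.orbitRel (some (Quotient.mk _ a, Quotient.mk _ b)) ∈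
      partialBrauerMonoid X ↔ σ.1 a = a ∧ τ.1 b = b := by
  rw [partialBrauerMonoid_eq_blockMonoid, ofKernels_mem_blockMonoid]
  constructor
  · rintro ⟨h, -⟩
    have h := h a
    rw [encard_transversal_of_rel (Setoid.refl' _ a)] at h
    by_cases ha : σ.1 a = a <;> by_cases hb : τ.1 b = b
    · exact ⟨ha, hb⟩
    · rw [encard_orbit_of_fixed ha, encard_orbit_of_not_fixed hb] at h
      exact absurd h (by decide)
    · rw [encard_orbit_of_not_fixed ha, encard_orbit_of_fixed hb] at h
      exact absurd h (by decide)
    · rw [encard_orbit_of_not_fixed ha, encard_orbit_of_not_fixed hb] at h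
      exact absurd h (by decide)
  · rintro ⟨ha, hb⟩
    refine ⟨fun x => ?_, fun y => ?_⟩
    · by_cases h : σ.orbitRel a x
      · obtain rfl : x = a := by
          rcases h with h | h
          exacts [h, h.trans ha]
        rw [encard_transversal_of_rel (Setoid.refl' _ x), encard_orbit_of_fixed ha,
          encard_orbit_of_fixed hb]
        norm_num
      · rw [encard_transversal_of_not_rel h, add_zero]
        exact encard_orbit_le_two σ x
    · by_cases h : τ.orbitRel b y
      · obtain rfl : y = b := by
          rcases h with h | h
          exacts [h, h.trans hb]
        rw [encard_transversal_of_rel' (Setoid.refl' _ y), encard_orbit_of_fixed ha,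
          encard_orbit_of_fixed hb]
        norm_num
      · rw [encard_transversal_of_not_rel' h, zero_add]
        exact encard_orbit_le_two τ y

/-- The transversal pairs up the only two singleton orbits; any further fixed point would be a block
of size one. -/
theorem ofKernels_some_mem_brauerMonoid {a b : X} (ha : ∀ x, σ.1 x = x ↔ x = a)
    (hb : ∀ y, τ.1 y = y ↔ y = b) :
    ofKernels σ.orbitRel τ.orbitRel (some (Quotient.mk _ a, Quotient.mk _ b)) ∈
      brauerMonoid X := by
  rw [brauerMonoid_eq_blockMonoid, ofKernels_mem_blockMonoid]
  have ha' := (ha a).2 rfl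
  have hb' := (hb b).2 rfl
  refine ⟨fun x => ?_, fun y => ?_⟩
  · by_cases h : x = a
    · subst h
      rw [encard_transversal_of_rel (Setoid.refl' _ x), encard_orbit_of_fixed ha',
        encard_orbit_of_fixed hb']
      norm_num
    · have hr : ¬ σ.orbitRel a x := by
        rw [orbitRel_iff, ha']
        tauto
      rw [encard_transversal_of_not_rel hr, add_zero,
        encard_orbit_of_not_fixed (mt (ha x).1 h)]
  · by_cases h : y = b
    · subst h
      rw [encard_transversal_of_rel' (Setoid.refl' _ y), encard_orbit_of_fixed ha',
        encard_orbit_of_fixed hb']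
      norm_num
    · have hr : ¬ τ.orbitRel b y := by
        rw [orbitRel_iff, hb']
        tauto
      rw [encard_transversal_of_not_rel' hr, zero_add,
        encard_orbit_of_not_fixed (mt (hb y).1 h)]

-- Admissible transversals join singleton classes, so they can be counted by pairs of points instead
-- of pairs of classes.
open Classical in
theorem ncard_ofKernels_mem [Finite X] {S : Set (DiagramPartition X)}
    (hS : S ⊆ partialBrauerMonoid X) :
    {o | ofKernels σ.orbitRel τ.orbitRel o ∈ S}.ncard =
      (if ofKernels σ.orbitRel τ.orbitRel none ∈ S then 1 else 0) +
      {q : X × X | ofKernels σ.orbitRel τ.orbitRel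
        (some (Quotient.mk _ q.1, Quotient.mk _ q.2)) ∈ S}.ncard := by
  rw [Option.ncard_setOf]
  congr 1
  symm
  refine Set.BijOn.ncard_eq
    (f := fun q => (Quotient.mk σ.orbitRel q.1, Quotient.mk τ.orbitRel q.2)) ⟨?_, ?_, ?_⟩
  · exact fun q hq => hq
  · rintro ⟨a, b⟩ hq ⟨a', b'⟩ - h
    obtain ⟨ha, hb⟩ := ofKernels_some_mem_partialBrauerMonoid.1 (hS hq)
    obtain ⟨h1, h2⟩ := Prod.mk.inj h
    refine Prod.ext ?_ ?_
    · rcases orbitRel_iff.1 (Quotient.exact h1) with h | h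
      exacts [h.symm, (h.trans ha).symm]
    · rcases orbitRel_iff.1 (Quotient.exact h2) with h | h
      exacts [h.symm, (h.trans hb).symm]
  · rintro ⟨⟨a⟩, ⟨b⟩⟩ h
    exact ⟨(a, b), h, rfl⟩

open Classical in
theorem c_eq_sum_involutions [Fintype X] [Nonempty X] [Fintype (InvolutiveMap X)]
    {S : Set (DiagramPartition X)} (hS : S ⊆ partialBrauerMonoid X) :
    c S = ∑ p : InvolutiveMap X × InvolutiveMap X with ActTransitively p.1.1 p.2.1,
      {o | ofKernels p.1.orbitRel p.2.orbitRel o ∈ S}.ncard := by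
  have : Finite (Setoid X) := Finite.of_injective (fun ε : Setoid X => ⇑ε)
    fun ε η h => Setoid.ext fun x y => iff_of_eq (congrFun₂ h x y)
  have := Fintype.ofFinite (Setoid X)
  rw [c_eq_sum]
  symm
  refine Finset.sum_of_injOn (fun p => (p.1.orbitRel, p.2.orbitRel)) ?_ ?_ ?_ fun _ _ => rfl
  · rintro ⟨σ, τ⟩ - ⟨σ', τ'⟩ - h
    obtain ⟨h1, h2⟩ := Prod.mk.inj h
    exact Prod.ext (orbitRel_injective h1) (orbitRel_injective h2)
  · rintro ⟨σ, τ⟩ h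
    simpa [orbitRel_sup_eq_top] using h
  · rintro ⟨ε, η⟩ hp hn
    rw [Set.ncard_eq_zero, Set.eq_empty_iff_forall_notMem]
    intro o ho
    obtain ⟨σ, τ, rfl, rfl⟩ := exists_orbitRel_eq_of_ofKernels_mem (hS ho)
    refine hn ⟨(σ, τ), ?_, rfl⟩
    simpa [orbitRel_sup_eq_top] using hp

variable [Fintype X] {n : ℕ}

theorem c_brauerMonoid_of_odd (hn : Fintype.card X = n) (ho : Odd n) :
    c (brauerMonoid X) = n.factorial := by
  classical
  have := Fintype.ofFinite (InvolutiveMap X)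
  have : Nonempty X := Fintype.card_pos_iff.1 (hn ▸ ho.pos)
  rw [c_eq_sum_involutions brauerMonoid_subset_partialBrauerMonoid,
    ← card_actTransitively_of_odd hn ho, Finset.card_eq_sum_ones]
  refine Finset.sum_congr rfl fun p hp => ?_
  obtain ⟨⟨a, ha⟩, b, hb⟩ :=
    existsUnique_fixed_points_of_odd hn p.1.2 p.2.2 (Finset.mem_filter.1 hp).2 ho
  rw [ncard_ofKernels_mem brauerMonoid_subset_partialBrauerMonoid, if_neg, zero_add,
    Set.ncard_eq_one]
  · refine ⟨(a, b), Set.eq_singleton_iff_unique_mem.2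
      ⟨ofKernels_some_mem_brauerMonoid ha hb, fun q hq => ?_⟩⟩
    obtain ⟨h1, h2⟩ := ofKernels_some_mem_partialBrauerMonoid.1
      (brauerMonoid_subset_partialBrauerMonoid hq)
    exact Prod.ext ((ha _).1 h1) ((hb _).1 h2)
  · rw [ofKernels_none_mem_brauerMonoid]
    exact fun h => (h a).1 ((ha a).2 rfl)

theorem c_partialBrauerMonoid_of_odd (hn : Fintype.card X = n) (ho : Odd n) :
    c (partialBrauerMonoid X) = 2 * n.factorial := by
  classical
  have := Fintype.ofFinite (InvolutiveMap X)
  have : Nonempty X := Fintype.card_pos_iff.1 (hn ▸ ho.pos)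
  rw [c_eq_sum_involutions subset_rfl, ← card_actTransitively_of_odd hn ho, mul_comm,
    ← smul_eq_mul, ← Finset.sum_const]
  refine Finset.sum_congr rfl fun p hp => ?_
  obtain ⟨⟨a, ha⟩, b, hb⟩ :=
    existsUnique_fixed_points_of_odd hn p.1.2 p.2.2 (Finset.mem_filter.1 hp).2 ho
  rw [ncard_ofKernels_mem subset_rfl, if_pos ofKernels_none_mem_partialBrauerMonoid]
  simp_rw [ofKernels_some_mem_partialBrauerMonoid, ha, hb]
  have : {q : X × X | q.1 = a ∧ q.2 = b} = {(a, b)} := by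
    ext q
    simp [Prod.ext_iff]
  rw [this, Set.ncard_singleton]

-- For even `n` a transitive pair never has fixed points of both involutions, so no transversal is
-- admissible.
open Classical in
theorem ncard_ofKernels_mem_of_even (hn : Fintype.card X = n) (he : Even n)
    {S : Set (DiagramPartition X)} (hS : S ⊆ partialBrauerMonoid X)
    (hc : ActTransitively σ.1 τ.1) :
    {o | ofKernels σ.orbitRel τ.orbitRel o ∈ S}.ncard =
      if ofKernels σ.orbitRel τ.orbitRel none ∈ S then 1 else 0 := by
  rw [ncard_ofKernels_mem hS, Nat.add_eq_left, Set.ncard_eq_zero,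
    Set.eq_empty_iff_forall_notMem]
  intro q hq
  obtain ⟨h1, h2⟩ := ofKernels_some_mem_partialBrauerMonoid.1 (hS hq)
  exact (fixed_points_of_even hn σ.2 τ.2 hc he h2).1 _ h1

theorem c_brauerMonoid_of_even (hn : Fintype.card X = n) (h0 : 0 < n) (he : Even n) :
    c (brauerMonoid X) = (n - 1).factorial := by
  classical
  have := Fintype.ofFinite (InvolutiveMap X)
  have : Nonempty X := Fintype.card_pos_iff.1 (hn ▸ h0)
  rw [c_eq_sum_involutions brauerMonoid_subset_partialBrauerMonoid,
    ← card_actTransitively_without_fixed_points hn h0 he, ← Finset.filter_filter,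
    Finset.card_filter]
  refine Finset.sum_congr rfl fun p hp => ?_
  rw [ncard_ofKernels_mem_of_even hn he brauerMonoid_subset_partialBrauerMonoid
    (Finset.mem_filter.1 hp).2]
  simp_rw [ofKernels_none_mem_brauerMonoid]

theorem c_partialBrauerMonoid_of_even (hn : Fintype.card X = n) (h0 : 0 < n) (he : Even n) :
    c (partialBrauerMonoid X) = (n + 1) * (n - 1).factorial := by
  classical
  have := Fintype.ofFinite (InvolutiveMap X)
  have : Nonempty X := Fintype.card_pos_iff.1 (hn ▸ h0)
  -- `(n + 1) * (n - 1)!` is split as `n! + (n - 1)!`, the paths and the cycles.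
  rw [c_eq_sum_involutions subset_rfl, add_mul, one_mul, Nat.mul_factorial_pred h0.ne',
    ← card_actTransitively_with_fixed_point hn h0 he,
    ← card_actTransitively_without_fixed_points hn h0 he, ← Finset.filter_filter,
    ← Finset.filter_filter, add_comm, Finset.card_filter_add_card_filter_not,
    Finset.card_eq_sum_ones]
  refine Finset.sum_congr rfl fun p hp => ?_
  rw [ncard_ofKernels_mem_of_even hn he subset_rfl (Finset.mem_filter.1 hp).2,
    if_pos ofKernels_none_mem_partialBrauerMonoid]

end Involution

end DiagramPartition

theorem mainTheorem2 :
    (∀ K : (n : ℕ) → Set (DiagramPartition (Fin n)),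
      (K = fun n => DiagramPartition.partitionMonoid (Fin n)) ∨
      (K = fun n => DiagramPartition.brauerMonoid (Fin n)) ∨
      (K = fun n => DiagramPartition.partialBrauerMonoid (Fin n)) →
      (∀ n : ℕ, (DiagramPartition.e (K n) : ℚ) =
        (n.factorial : ℚ) * ∑ μ : Nat.Partition n, ∏ i ∈ Finset.Icc 1 n,
          (DiagramPartition.c (K i) : ℚ) ^ (μ.parts.count i) /
            (((μ.parts.count i).factorial : ℚ) * (i.factorial : ℚ) ^ (μ.parts.count i))) ∧
      DiagramPartition.e (K 0) = 1 ∧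
      (∀ n : ℕ, 1 ≤ n → DiagramPartition.e (K n) =
        ∑ m ∈ Finset.Icc 1 n,
          (n - 1).choose (m - 1) * DiagramPartition.c (K m) * DiagramPartition.e (K (n - m)))) ∧
    (∀ n : ℕ, 1 ≤ n →
      DiagramPartition.c (DiagramPartition.partitionMonoid (Fin n)) =
        ∑ r ∈ Finset.Icc 1 n, ∑ s ∈ Finset.Icc 1 n,
          (1 + r * s) * DiagramPartition.joinPairs n r s) ∧
    (∀ n : ℕ, 1 ≤ n →
      DiagramPartition.c (DiagramPartition.brauerMonoid (Fin n)) =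
        if Odd n then n.factorial else (n - 1).factorial) ∧
    (∀ n : ℕ, 1 ≤ n →
      DiagramPartition.c (DiagramPartition.partialBrauerMonoid (Fin n)) =
        if Odd n then 2 * n.factorial else (n + 1) * (n - 1).factorial) := by
  open DiagramPartition in
  refine ⟨fun K hK => ?_, fun n hn => c_partitionMonoid hn, fun n hn => ?_, fun n hn => ?_⟩
  · obtain ⟨P, rfl⟩ : ∃ P, K = fun n => blockMonoid P (Fin n) := by
      rcases hK with rfl | rfl | rfl
      · exact ⟨_, funext fun _ => partitionMonoid_eq_blockMonoid⟩
      · exact ⟨_, funext fun _ => brauerMonoid_eq_blockMonoid⟩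
      · exact ⟨_, funext fun _ => partialBrauerMonoid_eq_blockMonoid⟩
    exact ⟨e_eq_sum_partition P, e_zero P, fun n hn => e_recurrence P hn⟩
  · split_ifs with h
    · exact c_brauerMonoid_of_odd (Fintype.card_fin n) h
    · exact c_brauerMonoid_of_even (Fintype.card_fin n) hn (Nat.not_odd_iff_even.1 h)
  · split_ifs with h
    · exact c_partialBrauerMonoid_of_odd (Fintype.card_fin n) h
    · exact c_partialBrauerMonoid_of_even (Fintype.card_fin n) hn (Nat.not_odd_iff_even.1 h)
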